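/- Let $d\ge 1$ and let $F$ be a distribution function (df) on $\mathbb R^d$ with univariate margins $F_1,\dots,F_d$. Let $C$ be a copula on $\mathbb R^d$ (a df with uniform margins on $[0,1]$) such that $F(x)=C(F_1(x_1),\dots,F_d(x_d))$ for all $x\in\mathbb R^d$. Let $\|\cdot\|_D$ be a $D$-norm on $\mathbb R^d$, i.e. $\|x\|_D=E\big(\max_{1\le i\le d}|x_i|Z_i\big)$ for a random vector $Z$ with $Z_i\ge 0$ and $E(Z_i)=1$, $1\le i\le d$, and suppose that $$C(u)=1-\|\mathbf 1-u\|_D+o(\|\mathbf 1-u\|)\qquad\text{as } u\to\mathbf 1,\ \text{uniformly for } u\in[0,1]^d .$$ Put $\omega(F_i)=\sup\{x\in\mathbb R: F_i(x)<1\}\in(-\infty,\infty]$ and suppose that for each $i$ the derivative $f_i=F_i'$ exists and is positive throughout some left neighborhood of $\omega(F_i)$, and that $F_i$ satisfies one of the following von Mises type conditions: (1) $\displaystyle\lim_{x\uparrow\omega(F_i)}\frac{f_i(x)\int_x^{\omega(F_i)}(1-F_i(t))\,dt}{(1-F_i(x))^2}=1$ (the integrals being finite); (2) $\omega(F_i)=\infty$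 and there is $\alpha_i>0$ with $\displaystyle\lim_{x\to\infty}\frac{x f_i(x)}{1-F_i(x)}=\alpha_i$; (3) $\omega(F_i)<\infty$ and there is $\alpha_i>0$ with $\displaystyle\lim_{x\uparrow\omega(F_i)}\frac{(\omega(F_i)-x) f_i(x)}{1-F_i(x)}=\alpha_i$. Let $X^{(1)},X^{(2)},\dots$ be independent random vectors with df $F$, and let $X_{1:n,i}\le\dots\le X_{n:n,i}$ denote the ordered values of the $i$-th components of $X^{(1)},\dots,X^{(n)}$. Let $k=k(n)=(k_1,\dots,k_d)\in\{1,\dots,n\}^d$, $n\in\mathbb N$, satisfy $k_i/k_j\to k_{ij}^2$ as $n\to\infty$ with $k_{ij}\in(0,\infty)$ for all $1\le i,j\le d$, $\|k\|\to\infty$ and $\|k\|/n\to 0$. Put $b_{ni}=F_i^{-1}(1-k_i/n)$, where $F_i^{-1}(u)=\inf\{t\in\mathbb R: F_i(t)\ge u\}$, and $a_{ni}=\sqrt{k_i}/(n f_i(b_{ni}))$ (which are well defined for large $n$). Let $c_{ni}>0$ and $d_{ni}\in\mathbb R$ be any sequences with $$\lim_{n\to\infty}\frac{c_{ni}}{a_{ni}}=1,\qquad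 \lim_{n\to\infty}\frac{d_{ni}-b_{ni}}{a_{ni}}=0,\qquad 1\le i\le d .$$ Then the matrix $\Sigma=(\sigma_{ij})$ with $\sigma_{ii}=1$ and $$\sigma_{ij}=k_{ij}+k_{ji}-\|k_{ij}e_i+k_{ji}e_j\|_D,\qquad i\ne j,$$ where $e_1,\dots,e_d$ are the unit vectors of $\mathbb R^d$, is positive semidefinite, and $$\left(\frac{X_{n-k_i+1:n,i}-d_{ni}}{c_{ni}}\right)_{i=1}^d\longrightarrow_D N(\mathbf 0,\Sigma)\qquad (n\to\infty).$$ -/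

import Mathlib

open Filter Topology MeasureTheory ProbabilityTheory

namespace IntermediateOS

/-- The `r`-th order statistic `x_{r:n}` (`1 ≤ r ≤ n`) of the first `n` terms `x 0, …, x (n-1)` of a
real sequence, i.e. the `r`-th smallest of them, counted with multiplicity.  (It is `0` when `r` is
not an admissible rank.) -/
noncomputable def orderStat (x : ℕ → ℝ) (n r : ℕ) : ℝ :=
  if h : 1 ≤ r ∧ r ≤ n then
    x (Tuple.sort (fun j : Fin n => x j) ⟨r - 1, by omega⟩)
  else 0

/-- `D` is a `D`-norm on `ℝ^d`: there is a generator `Z` (given here by its law `ν`) with `Z i ≥ 0`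
and `E (Z i) = 1` such that `D x = E (max_i |x i| * Z i)`.  (Such a `D` is automatically a norm.) -/
def IsDNorm {d : ℕ} (D : (Fin d → ℝ) → ℝ) : Prop :=
  ∃ ν : Measure (Fin d → ℝ), IsProbabilityMeasure ν ∧
    (∀ i, ∀ᵐ z ∂ν, 0 ≤ z i) ∧
    (∀ i, Integrable (fun z => z i) ν ∧ ∫ z, z i ∂ν = 1) ∧
    ∀ x, D x = ∫ z, (⨆ i, |x i| * z i) ∂ν

/-- `C` is a copula on `ℝ^d`: the distribution function of a probability measure on `ℝ^d` all of
whose one-dimensional margins are the uniform distribution on `[0, 1]`. -/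
def IsCopula {d : ℕ} (C : (Fin d → ℝ) → ℝ) : Prop :=
  ∃ ν : Measure (Fin d → ℝ), IsProbabilityMeasure ν ∧
    (∀ i, ν.map (fun u => u i) = (volume : Measure ℝ).restrict (Set.Icc 0 1)) ∧
    ∀ u, C u = ν.real (Set.Iic u)

/-- The expansion `C u = 1 - D (1 - u) + o(‖1 - u‖)` as `u → 1`, uniformly for `u ∈ [0,1]^d`. -/
def HasDNormExpansion {d : ℕ} (C D : (Fin d → ℝ) → ℝ) : Prop :=
  (fun u : Fin d → ℝ => C u - (1 - D (1 - u))) =o[𝓝[Set.Icc 0 1] 1]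
    (fun u : Fin d → ℝ => ‖1 - u‖)

/-- The distribution function of the `i`-th univariate margin of a probability measure `μ`. -/
noncomputable def marginCDF {d : ℕ} (μ : Measure (Fin d → ℝ)) (i : Fin d) : ℝ → ℝ :=
  fun t => cdf (μ.map (fun x => x i)) t

/-- The generalized inverse `F⁻¹ u = inf {t | F t ≥ u}`. -/
noncomputable def genInv (F : ℝ → ℝ) (u : ℝ) : ℝ := sInf {t : ℝ | u ≤ F t}

/-- The upper endpoint `ω(F) = sup {x | F x < 1}`, as an extended real. -/
noncomputable def upperEndpoint (F : ℝ → ℝ) : EReal :=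
  sSup (Real.toEReal '' {x : ℝ | F x < 1})

/-- The filter of left neighbourhoods of `w ∈ (-∞, ∞]`, expressing `x ↑ w` for real `x`: it is
`𝓝[<] w` for real `w` and `atTop` for `w = ∞`. -/
noncomputable def leftNhds (w : EReal) : Filter ℝ := comap Real.toEReal (𝓝[<] w)

/-- `F` has a positive derivative throughout some left neighbourhood of its upper endpoint. -/
def HasPosDerivNearEndpoint (F : ℝ → ℝ) : Prop :=
  ∀ᶠ x in leftNhds (upperEndpoint F), DifferentiableAt ℝ F x ∧ 0 < deriv F x

/-- Von Mises condition (1); the tail integral of `1 - F` is required to be finite. -/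
def VonMises1 (F : ℝ → ℝ) : Prop :=
  (∀ x : ℝ, IntegrableOn (fun t => 1 - F t) {t : ℝ | x < t ∧ (t : EReal) < upperEndpoint F}) ∧
  Tendsto
    (fun x => deriv F x * (∫ t in {t : ℝ | x < t ∧ (t : EReal) < upperEndpoint F}, (1 - F t)) /
      (1 - F x) ^ 2)
    (leftNhds (upperEndpoint F)) (𝓝 1)

/-- Von Mises condition (2). -/
def VonMises2 (F : ℝ → ℝ) : Prop :=
  upperEndpoint F = ⊤ ∧
  ∃ α : ℝ, 0 < α ∧ Tendsto (fun x => x * deriv F x / (1 - F x)) atTop (𝓝 α)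

/-- Von Mises condition (3). -/
def VonMises3 (F : ℝ → ℝ) : Prop :=
  ∃ w : ℝ, upperEndpoint F = w ∧
  ∃ α : ℝ, 0 < α ∧ Tendsto (fun x => (w - x) * deriv F x / (1 - F x)) (𝓝[<] w) (𝓝 α)

/-- The centering constant `b = F⁻¹(1 - k/n)`. -/
noncomputable def centering (F : ℝ → ℝ) (n k : ℕ) : ℝ := genInv F (1 - (k : ℝ) / n)

/-- The scaling constant `a = √k / (n f(b))` with `f = F'` and `b = F⁻¹(1 - k/n)`. -/
noncomputable def scaling (F : ℝ → ℝ) (n k : ℕ) : ℝ :=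
  √(k : ℝ) / (n * deriv F (centering F n k))

/-- The asymptotic covariance matrix: `σ i i = 1` and
`σ i j = κ i j + κ j i - D (κ i j • e_i + κ j i • e_j)` for `i ≠ j`. -/
noncomputable def asympCov {d : ℕ} (D : (Fin d → ℝ) → ℝ) (κ : Fin d → Fin d → ℝ) :
    Matrix (Fin d) (Fin d) ℝ :=
  Matrix.of fun i j =>
    if i = j then 1
    else κ i j + κ j i - D (κ i j • Pi.single i (1 : ℝ) + κ j i • Pi.single j (1 : ℝ))

end IntermediateOS

namespace IntermediateOS

/-! The `k`-th largest of `n` values is at most `t` exactly when fewer than `k` of them exceed `t`.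
So the normalized order statistic `W` satisfies `W ≤ x` iff the centred exceedance count over the
level `e + c x`, divided by `√k`, lies below `(k - n (1 - F (e + c x))) / √k`. The von Mises
conditions make this threshold tend to `x`. Replacing the level by `b`, where `n (1 - F b) = k`
eventually, changes the count by a variable whose variance is of order `1 / √k`. Ghosh's argument
then gives `W - V → 0` in probability, with `V` the normalized centred count over `b`
(`tendsto_measure_abs_orderStat_sub`).

The vector of the `V`'s is a row sum of i.i.d. centred terms bounded by `1 / √k`, so a
characteristic function computation gives a Gaussian limit once the covariances converge
(`tendstoInDistribution_sum_triangular`). With `p = k_i / n` and `q = k_j / n`, inclusion-exclusion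
and the copula expansion give `p + q - D (p e_i + q e_j) + o(p + q)` for the joint exceedance
probability. Multiplying by `n / √(k_i k_j)` and using homogeneity and continuity of `D` yields
`asympCov` (`tendsto_cov_centredExceed`), which is positive semidefinite as a limit of covariance
matrices.

For the threshold, the three von Mises cases are unified by a Lipschitz scale `g` with `g h → α >
0`, where `h = F' / (1 - F)`: the mean excess function, `x`, or `w - x` (`exists_isAuxiliaryScale`).
Shifts of size `o(g)` change `g`, hence also `h`, by a factor tending to `1`, and the mean value
theorem for `log (1 - F)` linearizes the tail without continuity of `F'`
(`tendsto_sqrt_mul_tail_ratio_sub_one`). -/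

/-! ### Order statistics and exceedance counts -/

lemma orderStat_le_iff (x : ℕ → ℝ) {n k : ℕ} (hk : 1 ≤ k) (hkn : k ≤ n) (t : ℝ) :
    orderStat x n (n - k + 1) ≤ t ↔ ((Finset.range n).filter (fun j => t < x j)).card < k := by
  have h : 1 ≤ n - k + 1 ∧ n - k + 1 ≤ n := by omega
  have hcard : ((Finset.range n).filter (fun j => t < x j)).card =
      (Finset.univ.filter (fun j : Fin n => ¬ x j ≤ t)).card := by
    rw [Finset.card_filter, Finset.sum_range, Finset.card_filter]
    simp
  have hperm : (Finset.univ.filter (fun j : Fin n =>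
        ((fun j : Fin n => x j) ∘ Tuple.sort (fun j : Fin n => x j)) j ≤ t)).card =
      (Finset.univ.filter (fun j : Fin n => x j ≤ t)).card := by
    rw [Finset.card_filter, Finset.card_filter]
    exact Equiv.sum_comp (Tuple.sort (fun j : Fin n => x j))
      (fun j : Fin n => if x j ≤ t then 1 else 0)
  -- Rank `n - k + 1` has zero-based index `n - k`: the sorted value there is at most `t` iff more
  -- than `n - k` entries are.
  have key := Tuple.lt_card_le_iff_apply_le_of_monotone (j := ⟨n - k + 1 - 1, by omega⟩) (a := t)
    (Tuple.monotone_sort (fun j : Fin n => x j))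
  rw [hperm] at key
  have htot := Finset.card_filter_add_card_filter_not (s := (Finset.univ : Finset (Fin n)))
    (fun j : Fin n => x j ≤ t)
  rw [Finset.card_univ, Fintype.card_fin] at htot
  rw [orderStat, dif_pos h]
  refine key.symm.trans ?_
  rw [hcard]
  simp only
  omega

lemma card_filter_lt_eq_sum (x : ℕ → ℝ) (n : ℕ) (t : ℝ) :
    (((Finset.range n).filter (fun j => t < x j)).card : ℝ) =
      ∑ j ∈ Finset.range n, (Set.Ioi t).indicator (fun _ => (1 : ℝ)) (x j) := by
  rw [Finset.card_filter]
  push_cast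
  exact Finset.sum_congr rfl fun j _ => by simp [Set.indicator_apply]

lemma measurable_orderStat (n r : ℕ) : Measurable fun x : ℕ → ℝ => orderStat x n r := by
  by_cases h : 1 ≤ r ∧ r ≤ n
  · refine measurable_of_Iic fun t => ?_
    have hr : r = n - (n - r + 1) + 1 := by omega
    have : (fun x : ℕ → ℝ => orderStat x n r) ⁻¹' Set.Iic t =
        {x | ∑ j ∈ Finset.range n, (Set.Ioi t).indicator (fun _ => (1 : ℝ)) (x j)
          < ((n - r + 1 : ℕ) : ℝ)} := by
      ext x
      simp only [Set.mem_preimage, Set.mem_Iic, Set.mem_ofPred_eq]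
      rw [← card_filter_lt_eq_sum, Nat.cast_lt]
      conv_lhs => rw [hr]
      exact orderStat_le_iff x (by omega) (by omega) t
    rw [this]
    refine measurableSet_lt (Finset.measurable_sum _ fun j _ => ?_) measurable_const
    exact (measurable_const.indicator measurableSet_Ioi).comp (measurable_pi_apply j)
  · simp [orderStat, h]

/-! ### A central limit theorem for triangular arrays -/

/-- Characteristic functions of the row sums of a uniformly small, centred triangular array. -/
lemma tendsto_integral_cexp_pow {α : Type*} [MeasurableSpace α] (μ : Measure α)
    [IsProbabilityMeasure μ] (φ : ℕ → α → ℝ) (hφ : ∀ n, Measurable (φ n)) (δ : ℕ → ℝ)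
    (hδ : Tendsto δ atTop (𝓝 0)) (hb : ∀ n x, |φ n x| ≤ δ n) (h0 : ∀ n, ∫ x, φ n x ∂μ = 0)
    (v : ℝ) (hv : Tendsto (fun n : ℕ => n * ∫ x, φ n x ^ 2 ∂μ) atTop (𝓝 v)) :
    Tendsto (fun n => (∫ x, Complex.exp (φ n x * Complex.I) ∂μ) ^ n) atTop
      (𝓝 (Complex.exp (-v / 2))) := by
  have hint : ∀ n, Integrable (φ n) μ := fun n =>
    Integrable.of_bound (hφ n).aestronglyMeasurable (δ n) (ae_of_all _ (hb n))
  have hint2 : ∀ n, Integrable (fun x => φ n x ^ 2) μ := fun n =>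
    Integrable.of_bound ((hφ n).pow_const 2).aestronglyMeasurable (δ n ^ 2)
      (ae_of_all _ fun x => by
        rw [Real.norm_eq_abs, abs_pow]; exact pow_le_pow_left₀ (abs_nonneg _) (hb n x) 2)
  have hinte : ∀ n, Integrable (fun x => Complex.exp (φ n x * Complex.I)) μ := fun n =>
    Integrable.of_bound (by have := hφ n; fun_prop) 1
      (ae_of_all _ fun x => by rw [Complex.norm_exp_ofReal_mul_I])
  -- The second-order Taylor remainder of the characteristic function. Since `|φ|³ ≤ δ φ²`, it
  -- satisfies `n R → 0`.
  set R : ℕ → ℂ := fun n => ∫ x, Complex.exp (φ n x * Complex.I) ∂μ - 1 +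
    ((∫ x, φ n x ^ 2 ∂μ : ℝ) : ℂ) / 2 with hR
  have hpt : ∀ y : ℝ, |y| ≤ 1 →
      ‖Complex.exp (y * Complex.I) - 1 - y * Complex.I + (y : ℂ) ^ 2 / 2‖ ≤ |y| ^ 3 := by
    intro y hy
    have hn : ‖(y : ℂ) * Complex.I‖ = |y| := by simp
    have := Complex.exp_bound (x := y * Complex.I) (by rw [hn]; exact hy) (n := 3) (by norm_num)
    rw [hn] at this
    simp only [Finset.sum_range_succ, Finset.sum_range_zero] at this
    have e : Complex.exp (y * Complex.I) - (0 + (y * Complex.I) ^ 0 / (Nat.factorial 0 : ℕ) +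
        (y * Complex.I) ^ 1 / (Nat.factorial 1 : ℕ) + (y * Complex.I) ^ 2 / (Nat.factorial 2 : ℕ))
        = Complex.exp (y * Complex.I) - 1 - y * Complex.I + (y : ℂ) ^ 2 / 2 := by
      simp only [mul_pow, Complex.I_sq]
      simp [Nat.factorial]
      ring
    rw [e] at this
    refine this.trans (mul_le_of_le_one_right (by positivity) ?_)
    norm_num [Nat.factorial]
  have hRb : ∀ᶠ n : ℕ in atTop, ‖(n : ℂ) * R n‖ ≤ δ n * (n * ∫ x, φ n x ^ 2 ∂μ) := by
    filter_upwards [hδ.eventually (ge_mem_nhds (zero_lt_one))] with n hn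
    have e : R n = ∫ x, (Complex.exp (φ n x * Complex.I) - 1 - φ n x * Complex.I
        + (φ n x : ℂ) ^ 2 / 2) ∂μ := by
      rw [integral_add, integral_sub, integral_sub]
      · simp only [hR, integral_mul_const, integral_const, integral_div]
        have h1 : ∫ x, (φ n x : ℂ) ∂μ = 0 := by
          have := integral_ofReal (𝕜 := ℂ) (f := φ n) (μ := μ)
          rw [h0] at this
          simpa using this
        have : ∫ x, (φ n x : ℂ) ^ 2 ∂μ = ((∫ x, φ n x ^ 2 ∂μ : ℝ) : ℂ) := by
          have := integral_ofReal (𝕜 := ℂ) (f := fun x => φ n x ^ 2) (μ := μ)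
          simpa using this
        rw [h1, this]
        simp
      · exact hinte n
      · exact integrable_const _
      · exact (hinte n).sub (integrable_const _)
      · exact (hint n).ofReal.mul_const _
      · exact ((hinte n).sub (integrable_const _)).sub ((hint n).ofReal.mul_const _)
      · have := (hint2 n).ofReal (𝕜 := ℂ)
        refine Integrable.div_const ?_ _
        simpa using this
    rw [norm_mul, Complex.norm_natCast, mul_left_comm]
    refine mul_le_mul_of_nonneg_left ?_ (Nat.cast_nonneg n)
    rw [e, ← integral_const_mul]
    refine norm_integral_le_of_norm_le ((hint2 n).const_mul _) (ae_of_all _ fun x => ?_)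
    refine (hpt _ ((hb n x).trans hn)).trans ?_
    rw [pow_succ', sq_abs]
    exact mul_le_mul_of_nonneg_right (hb n x) (sq_nonneg _)
  have hR0 : Tendsto (fun n : ℕ => (n : ℂ) * R n) atTop (𝓝 0) := by
    refine squeeze_zero_norm' hRb ?_
    simpa using hδ.mul hv
  have key : Tendsto (fun n : ℕ => (n : ℂ) * (∫ x, Complex.exp (φ n x * Complex.I) ∂μ - 1)) atTop
      (𝓝 (-v / 2)) := by
    have h2 : Tendsto (fun n : ℕ => ((n * ∫ x, φ n x ^ 2 ∂μ : ℝ) : ℂ)) atTop (𝓝 (v : ℂ)) :=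
      (Complex.continuous_ofReal.tendsto v).comp hv
    have := hR0.sub (h2.div_const 2)
    rw [zero_sub, ← neg_div] at this
    refine this.congr fun n => ?_
    simp only [hR]
    push_cast
    ring
  refine (Complex.tendsto_one_add_pow_exp_of_tendsto key).congr fun n => ?_
  rw [add_sub_cancel]

/-- The second moment of a linear combination as a quadratic form in the mixed second moments. -/
lemma mul_integral_sum_sq {α : Type*} [MeasurableSpace α] (μ : Measure α) {d : ℕ}
    (f : Fin d → α → ℝ) (hint : ∀ i j, Integrable (fun x => f i x * f j x) μ) (t : Fin d → ℝ)
    (r : ℝ) : r * ∫ x, (∑ i, t i * f i x) ^ 2 ∂μ =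
      ∑ i, ∑ j, t i * t j * (r * ∫ x, f i x * f j x ∂μ) := by
  have e : ∀ x, (∑ i, t i * f i x) ^ 2 = ∑ i, ∑ j, t i * t j * (f i x * f j x) := by
    intro x
    rw [sq, Finset.sum_mul_sum]
    exact Finset.sum_congr rfl fun i _ => Finset.sum_congr rfl fun j _ => by ring
  simp_rw [e]
  rw [integral_finsetSum _ fun i _ => integrable_finsetSum _ fun j _ =>
    (hint i j).const_mul _, Finset.mul_sum]
  refine Finset.sum_congr rfl fun i _ => ?_
  rw [integral_finsetSum _ fun j _ => (hint i j).const_mul _, Finset.mul_sum]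
  refine Finset.sum_congr rfl fun j _ => ?_
  rw [integral_const_mul]
  ring

lemma dotProduct_mulVec_eq_sum {d : ℕ} (S : Matrix (Fin d) (Fin d) ℝ) (t : Fin d → ℝ) :
    t ⬝ᵥ S.mulVec t = ∑ i, ∑ j, t i * t j * S i j := by
  simp only [dotProduct, Matrix.mulVec, Finset.mul_sum]
  exact Finset.sum_congr rfl fun i _ => Finset.sum_congr rfl fun j _ => by ring

/-- A multivariate central limit theorem for uniformly small, centred triangular arrays whose
rows are functions of i.i.d. observations. -/
theorem tendstoInDistribution_sum_triangular {α : Type*} [MeasurableSpace α] (μ : Measure α)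
    [IsProbabilityMeasure μ] {Ω : Type*} [MeasurableSpace Ω] (P : Measure Ω)
    [IsProbabilityMeasure P] (X : ℕ → Ω → α) (hlaw : ∀ j, HasLaw (X j) μ P)
    (hindep : iIndepFun X P) {d : ℕ} (ψ : ℕ → Fin d → α → ℝ) (hψ : ∀ n i, Measurable (ψ n i))
    (δ : ℕ → Fin d → ℝ) (hδ : ∀ i, Tendsto (fun n => δ n i) atTop (𝓝 0))
    (hb : ∀ n i x, |ψ n i x| ≤ δ n i) (h0 : ∀ n i, ∫ x, ψ n i x ∂μ = 0)
    (S : Matrix (Fin d) (Fin d) ℝ) (hS : S.PosSemidef)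
    (hv : ∀ i j, Tendsto (fun n : ℕ => n * ∫ x, ψ n i x * ψ n j x ∂μ) atTop (𝓝 (S i j))) :
    TendstoInDistribution
      (fun (n : ℕ) (ω : Ω) => WithLp.toLp 2 (fun i => ∑ j ∈ Finset.range n, ψ n i (X j ω)))
      atTop (fun z : EuclideanSpace ℝ (Fin d) => z) (fun _ => P) (multivariateGaussian 0 S) := by
  have hX : ∀ j, AEMeasurable (X j) P := fun j => (hlaw j).aemeasurable
  set Ψ : ℕ → α → EuclideanSpace ℝ (Fin d) := fun n x => WithLp.toLp 2 (fun i => ψ n i x) with hΨ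
  have hΨm : ∀ n, Measurable (Ψ n) := fun n =>
    (WithLp.measurable_toLp 2 _).comp (measurable_pi_lambda _ (hψ n))
  have hsum : ∀ n ω, WithLp.toLp 2 (fun i => ∑ j ∈ Finset.range n, ψ n i (X j ω)) =
      ∑ j ∈ Finset.range n, Ψ n (X j ω) := by
    intro n ω
    ext i
    simp [hΨ]
  simp_rw [hsum]
  refine ⟨fun n => Finset.aemeasurable_fun_sum _ fun j _ => (hΨm n).comp_aemeasurable (hX j),
    by fun_prop, ?_⟩
  refine ProbabilityMeasure.tendsto_iff_tendsto_charFun.2 fun t => ?_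
  simp only [ProbabilityMeasure.coe_mk, Measure.map_id']
  rw [charFun_multivariateGaussian hS]
  have hchar : ∀ n, charFun (P.map fun ω => ∑ j ∈ Finset.range n, Ψ n (X j ω)) t =
      (∫ x, Complex.exp ((∑ i, t i * ψ n i x : ℝ) * Complex.I) ∂μ) ^ n := by
    intro n
    rw [((hindep.comp (fun _ => Ψ n) (fun _ => hΨm n)).restrict
      _).charFun_map_fun_finsetSum_eq_prod (X := fun j ω => Ψ n (X j ω))
      (fun j _ => (hΨm n).comp_aemeasurable (hX j))]
    rw [Finset.prod_apply, Finset.prod_eq_pow_card (b := charFun (μ.map (Ψ n)) t)]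
    · rw [Finset.card_range, charFun_apply, integral_map (hΨm n).aemeasurable (by fun_prop)]
      congr 2
    · intro j _
      rw [← (hlaw j).map_eq, AEMeasurable.map_map_of_aemeasurable (hΨm n).aemeasurable (hX j)]
      rfl
  simp_rw [hchar]
  have hint : ∀ n i j, Integrable (fun x => ψ n i x * ψ n j x) μ := fun n i j =>
    Integrable.of_bound ((hψ n i).mul (hψ n j)).aestronglyMeasurable (δ n i * δ n j)
      (ae_of_all _ fun x => by
        rw [norm_mul]
        exact mul_le_mul (hb n i x) (hb n j x) (norm_nonneg _) ((abs_nonneg _).trans (hb n i x)))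
  have hint1 : ∀ n i, Integrable (ψ n i) μ := fun n i =>
    Integrable.of_bound (hψ n i).aestronglyMeasurable (δ n i) (ae_of_all _ (hb n i))
  -- Cramér–Wold: only the scalar array of combinations `∑ t_i ψ_i` matters, and it inherits uniform
  -- smallness and centring.
  have main := tendsto_integral_cexp_pow μ (fun n x => ∑ i, t i * ψ n i x)
    (fun n => Finset.measurable_sum _ fun i _ => (hψ n i).const_mul _)
    (fun n => ∑ i, |t i| * δ n i)
    (by simpa using tendsto_finsetSum Finset.univ fun i _ => (hδ i).const_mul |t i|)
    (fun n x => (Finset.abs_sum_le_sum_abs _ _).trans (Finset.sum_le_sum fun i _ => by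
      rw [abs_mul]; exact mul_le_mul_of_nonneg_left (hb n i x) (abs_nonneg _)))
    (fun n => by
      rw [integral_finsetSum _ fun i _ => (hint1 n i).const_mul _]
      simp [integral_const_mul, h0])
    (∑ i, ∑ j, t i * t j * S i j)
    (by
      have : Tendsto (fun n : ℕ => ∑ i, ∑ j, t i * t j * (n * ∫ x, ψ n i x * ψ n j x ∂μ)) atTop
          (𝓝 (∑ i, ∑ j, t i * t j * S i j)) :=
        tendsto_finsetSum _ fun i _ => tendsto_finsetSum _ fun j _ => (hv i j).const_mul _
      exact this.congr fun n => (mul_integral_sum_sq μ (ψ n) (hint n) t n).symm)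
  convert main using 3
  rw [dotProduct_mulVec_eq_sum]
  simp
  ring

/-! ### From order statistics to exceedance counts -/

/-- Ghosh's lemma: pointwise comparison of distribution functions along fixed levels, together
with tightness of one sequence, gives closeness in probability. -/
lemma tendsto_measure_abs_sub_of_tight {Ω : Type*} [MeasurableSpace Ω] (P : Measure Ω)
    (W V : ℕ → Ω → ℝ)
    (htight : ∀ δ : ENNReal, 0 < δ → ∃ M : ℝ, ∀ᶠ n in atTop, P {ω | M ≤ |V n ω|} ≤ δ)
    (hle : ∀ x ε : ℝ, 0 < ε → Tendsto (fun n => P {ω | W n ω ≤ x ∧ x + ε ≤ V n ω}) atTop (𝓝 0))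
    (hlt : ∀ x ε : ℝ, 0 < ε → Tendsto (fun n => P {ω | x < W n ω ∧ V n ω ≤ x - ε}) atTop (𝓝 0))
    (ε : ℝ) (hε : 0 < ε) :
    Tendsto (fun n => P {ω | ε ≤ |W n ω - V n ω|}) atTop (𝓝 0) := by
  rw [ENNReal.tendsto_nhds_zero]
  intro δ hδ
  obtain ⟨M, hM⟩ := htight (δ / 2) (ENNReal.half_pos hδ.ne')
  -- If `|V| < M` and `|W - V| ≥ ε = 3η`, some grid point `jη` lies between `V` and `W` at distance
  -- at least `η` from `V` and less than `2η`. The choice of `N` keeps all such `j` in a fixed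
  -- finite range.
  set η := ε / 3 with hη
  have hη0 : 0 < η := by positivity
  obtain ⟨N, hN⟩ := exists_nat_gt (M / η + 2)
  set I : Finset ℤ := Finset.Icc (-N) N
  have hlim : Tendsto (fun n => ∑ j ∈ I, (P {ω | W n ω ≤ j * η ∧ j * η + η ≤ V n ω} +
      P {ω | j * η < W n ω ∧ V n ω ≤ j * η - η})) atTop (𝓝 0) := by
    have := tendsto_finsetSum (f := fun (j : ℤ) n => P {ω | W n ω ≤ j * η ∧ j * η + η ≤ V n ω} +
      P {ω | j * η < W n ω ∧ V n ω ≤ j * η - η}) I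
      fun j _ => (hle (j * η) η hη0).add (hlt (j * η) η hη0)
    simpa using this
  filter_upwards [hM, ENNReal.tendsto_nhds_zero.1 hlim (δ / 2) (ENNReal.half_pos hδ.ne')]
    with n h1 h2
  have hsub : {ω | ε ≤ |W n ω - V n ω|} ⊆ {ω | M ≤ |V n ω|} ∪
      ⋃ j ∈ I, ({ω | W n ω ≤ j * η ∧ j * η + η ≤ V n ω} ∪
        {ω | j * η < W n ω ∧ V n ω ≤ j * η - η}) := by
    intro ω hω
    rw [Set.mem_ofPred_eq] at hω
    by_cases hV : M ≤ |V n ω|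
    · exact Or.inl hV
    right
    rw [not_le] at hV
    have hMη : M < (N - 2) * η := by
      rw [← div_lt_iff₀ hη0]; linarith
    obtain ⟨hV1, hV2⟩ := abs_lt.1 hV
    simp only [Set.mem_iUnion, exists_prop]
    rcases le_abs.1 hω with h | h
    · set j := ⌈V n ω / η + 1⌉ with hj
      have hj1 : V n ω / η + 1 ≤ j := Int.le_ceil _
      have hj2 : (j : ℝ) < V n ω / η + 1 + 1 := Int.ceil_lt_add_one _
      have e : V n ω / η * η = V n ω := div_mul_cancel₀ _ hη0.ne'
      have k1 : V n ω + η ≤ j * η := by nlinarith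
      have k2 : (j : ℝ) * η < V n ω + 2 * η := by nlinarith
      refine ⟨j, ?_, Or.inr ⟨by linarith, by linarith⟩⟩
      rw [Finset.mem_Icc]
      constructor
      · have : -(N : ℝ) < j := by
          refine lt_of_mul_lt_mul_right (a := η) ?_ hη0.le
          nlinarith
        exact_mod_cast this.le
      · have : (j : ℝ) < N := by
          refine lt_of_mul_lt_mul_right (a := η) ?_ hη0.le
          nlinarith
        exact_mod_cast this.le
    · set j := ⌊V n ω / η - 1⌋ with hj
      have hj1 : j ≤ V n ω / η - 1 := Int.floor_le _
      have hj2 : V n ω / η - 1 < j + 1 := Int.lt_floor_add_one _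
      have e : V n ω / η * η = V n ω := div_mul_cancel₀ _ hη0.ne'
      have k1 : j * η ≤ V n ω - η := by nlinarith
      have k2 : V n ω - 2 * η < (j : ℝ) * η := by nlinarith
      refine ⟨j, ?_, Or.inl ⟨by linarith, by linarith⟩⟩
      rw [Finset.mem_Icc]
      constructor
      · have : -(N : ℝ) < j := by
          refine lt_of_mul_lt_mul_right (a := η) ?_ hη0.le
          nlinarith
        exact_mod_cast this.le
      · have : (j : ℝ) < N := by
          refine lt_of_mul_lt_mul_right (a := η) ?_ hη0.le
          nlinarith
        exact_mod_cast this.le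
  refine (measure_mono hsub).trans ((measure_union_le _ _).trans ?_)
  rw [← ENNReal.add_halves δ]
  refine add_le_add h1 (le_trans ?_ h2)
  exact (measure_biUnion_finset_le _ _).trans (Finset.sum_le_sum fun j _ => measure_union_le _ _)

/-- Chebyshev's inequality for sums of functions of i.i.d. observations. -/
lemma measure_abs_sum_sub_ge_le {α : Type*} [MeasurableSpace α] (μ : Measure α)
    [IsProbabilityMeasure μ] {Ω : Type*} [MeasurableSpace Ω] (P : Measure Ω)
    [IsProbabilityMeasure P] (X : ℕ → Ω → α) (hlaw : ∀ j, HasLaw (X j) μ P)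
    (hindep : iIndepFun X P) (f : α → ℝ) (hf : Measurable f) (B : ℝ) (hB : ∀ x, |f x| ≤ B)
    (n : ℕ) (η : ℝ) (hη : 0 < η) :
    P {ω | η ≤ |∑ j ∈ Finset.range n, (f (X j ω) - ∫ x, f x ∂μ)|} ≤
      ENNReal.ofReal (n * (∫ x, f x ^ 2 ∂μ) / η ^ 2) := by
  have hX : ∀ j, AEMeasurable (X j) P := fun j => (hlaw j).aemeasurable
  have hL : MemLp f 2 μ := MemLp.of_bound hf.aestronglyMeasurable B (ae_of_all _ hB)
  have hL' : ∀ j, MemLp (fun ω => f (X j ω)) 2 P := fun j =>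
    MemLp.of_bound (hf.comp_aemeasurable (hX j)).aestronglyMeasurable B
      (ae_of_all _ fun ω => hB _)
  have hmean : ∀ j, ∫ ω, f (X j ω) ∂P = ∫ x, f x ∂μ := fun j => by
    rw [← (hlaw j).map_eq, integral_map (hX j) hf.aestronglyMeasurable]
  have hvar : ∀ j, Var[fun ω => f (X j ω); P] = Var[f; μ] := fun j => by
    rw [← (hlaw j).map_eq, variance_map hf.aemeasurable (hX j)]
    rfl
  have hsumL : MemLp (∑ j ∈ Finset.range n, fun ω => f (X j ω)) 2 P :=
    memLp_finsetSum' _ fun j _ => hL' j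
  have hv : Var[∑ j ∈ Finset.range n, fun ω => f (X j ω); P] ≤ n * ∫ x, f x ^ 2 ∂μ := by
    rw [IndepFun.variance_sum (fun j _ => hL' j)]
    · simp only [hvar, Finset.sum_const, Finset.card_range, nsmul_eq_mul]
      refine mul_le_mul_of_nonneg_left ?_ (Nat.cast_nonneg n)
      have := variance_le_expectation_sq (μ := μ) (X := f) hf.aestronglyMeasurable
      simpa using this
    · intro i _ j _ hij
      exact (hindep.comp (fun _ => f) (fun _ => hf)).indepFun hij
  have hm : ∫ ω, (∑ j ∈ Finset.range n, fun ω => f (X j ω)) ω ∂P = n * ∫ x, f x ∂μ := by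
    simp only [Finset.sum_apply]
    rw [integral_finsetSum _ fun j _ => (hL' j).integrable (by norm_num)]
    simp [hmean]
  have := meas_ge_le_variance_div_sq hsumL hη
  rw [hm] at this
  refine le_trans (le_of_eq ?_) (this.trans (ENNReal.ofReal_le_ofReal (by gcongr)))
  congr 1
  ext ω
  simp

/-- The indicator of exceeding a level, centred under `ν`. -/
noncomputable def centredExceed (ν : Measure ℝ) (t : ℝ) (y : ℝ) : ℝ :=
  (Set.Ioi t).indicator (fun _ => (1 : ℝ)) y - ν.real (Set.Ioi t)

lemma measurable_centredExceed (ν : Measure ℝ) (t : ℝ) : Measurable (centredExceed ν t) :=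
  (measurable_const.indicator measurableSet_Ioi).sub_const _

lemma integral_indicator_Ioi_one (ν : Measure ℝ) (t : ℝ) :
    ∫ y, (Set.Ioi t).indicator (fun _ => (1 : ℝ)) y ∂ν = ν.real (Set.Ioi t) := by
  rw [integral_indicator measurableSet_Ioi]
  simp

lemma integrable_indicator_Ioi_one (ν : Measure ℝ) [IsFiniteMeasure ν] (t : ℝ) :
    Integrable ((Set.Ioi t).indicator (fun _ => (1 : ℝ))) ν :=
  (integrable_const _).indicator measurableSet_Ioi

lemma integral_centredExceed (ν : Measure ℝ) [IsProbabilityMeasure ν] (t : ℝ) :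
    ∫ y, centredExceed ν t y ∂ν = 0 := by
  unfold centredExceed
  rw [integral_sub (integrable_indicator_Ioi_one ν t) (integrable_const _),
    integral_indicator_Ioi_one]
  simp

lemma abs_indicator_Ioi_one_le (t y : ℝ) : |(Set.Ioi t).indicator (fun _ => (1 : ℝ)) y| ≤ 1 := by
  by_cases h : y ∈ Set.Ioi t <;> simp [h]

lemma abs_centredExceed_le (ν : Measure ℝ) [IsProbabilityMeasure ν] (t y : ℝ) :
    |centredExceed ν t y| ≤ 1 := by
  have h0 : 0 ≤ ν.real (Set.Ioi t) := measureReal_nonneg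
  have h1 : ν.real (Set.Ioi t) ≤ 1 := measureReal_le_one
  unfold centredExceed
  rw [abs_le]
  by_cases h : y ∈ Set.Ioi t <;>
    simp only [h, Set.indicator_of_mem, not_false_eq_true, Set.indicator_of_notMem] <;>
    constructor <;> linarith

/-- Half-lines are nested, so the difference is, up to sign, the indicator of an interval and
squaring only removes the sign. This controls the variance caused by changing the level. -/
lemma integral_sq_sub_indicator_Ioi (ν : Measure ℝ) [IsProbabilityMeasure ν] (s t : ℝ) :
    ∫ y, ((Set.Ioi s).indicator (fun _ => (1 : ℝ)) y -
      (Set.Ioi t).indicator (fun _ => (1 : ℝ)) y) ^ 2 ∂ν =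
      |ν.real (Set.Ioi s) - ν.real (Set.Ioi t)| := by
  wlog hst : s ≤ t generalizing s t
  · rw [abs_sub_comm, ← this t s (le_of_not_ge hst)]
    exact integral_congr_ae (ae_of_all _ fun y => by ring)
  have e : ∀ y, ((Set.Ioi s).indicator (fun _ => (1 : ℝ)) y -
      (Set.Ioi t).indicator (fun _ => (1 : ℝ)) y) ^ 2 = (Set.Ioi s).indicator (fun _ => (1 : ℝ)) y -
      (Set.Ioi t).indicator (fun _ => (1 : ℝ)) y := by
    intro y
    by_cases h1 : s < y <;> by_cases h2 : t < y <;> simp [h1, h2]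
    linarith
  simp_rw [e]
  rw [integral_sub (integrable_indicator_Ioi_one ν s) (integrable_indicator_Ioi_one ν t),
    integral_indicator_Ioi_one, integral_indicator_Ioi_one, abs_of_nonneg]
  exact sub_nonneg.2 (measureReal_mono (Set.Ioi_subset_Ioi hst))

/-- A normalized intermediate order statistic is asymptotically equal, in probability, to the
normalized and centred number of exceedances over the centring level. -/
theorem tendsto_measure_abs_orderStat_sub {Ω : Type*} [MeasurableSpace Ω] (P : Measure Ω)
    [IsProbabilityMeasure P] (ν : Measure ℝ) [IsProbabilityMeasure ν] (Y : ℕ → Ω → ℝ)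
    (hlaw : ∀ j, HasLaw (Y j) ν P) (hindep : iIndepFun Y P) (k : ℕ → ℕ)
    (hk : ∀ n, 1 ≤ n → 1 ≤ k n ∧ k n ≤ n) (hkinf : Tendsto (fun n => (k n : ℝ)) atTop atTop)
    (b : ℕ → ℝ) (hb : ∀ᶠ n : ℕ in atTop, n * ν.real (Set.Ioi (b n)) = k n)
    (c e : ℕ → ℝ) (hc : ∀ n, 1 ≤ n → 0 < c n)
    (hce : ∀ x, Tendsto (fun n : ℕ => (k n - n * ν.real (Set.Ioi (e n + c n * x))) / √(k n : ℝ))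
      atTop (𝓝 x)) (ε : ℝ) (hε : 0 < ε) :
    Tendsto (fun n => P {ω | ε ≤ |(orderStat (fun j => Y j ω) n (n - k n + 1) - e n) / c n -
      ∑ j ∈ Finset.range n, centredExceed ν (b n) (Y j ω) / √(k n : ℝ)|}) atTop (𝓝 0) := by
  set G : ℝ → ℝ := fun t => ν.real (Set.Ioi t) with hG
  set J : ℝ → ℝ → ℝ := fun t => (Set.Ioi t).indicator (fun _ => (1 : ℝ)) with hJ
  set V : ℕ → Ω → ℝ := fun n ω => ∑ j ∈ Finset.range n, centredExceed ν (b n) (Y j ω) / √(k n : ℝ)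
    with hV
  set U : ℝ → ℕ → Ω → ℝ := fun x n ω =>
    ∑ j ∈ Finset.range n, centredExceed ν (e n + c n * x) (Y j ω) / √(k n : ℝ) with hU
  have hkpos : ∀ᶠ n in atTop, 1 ≤ n ∧ 0 < (k n : ℝ) := by
    filter_upwards [eventually_ge_atTop 1] with n hn
    exact ⟨hn, by exact_mod_cast (hk n hn).1⟩
  have hsqrt : Tendsto (fun n => √(k n : ℝ)) atTop atTop := Real.tendsto_sqrt_atTop.comp hkinf
  -- the order statistic in terms of exceedances
  have hiff : ∀ x, ∀ᶠ n in atTop, ∀ ω,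
      ((orderStat (fun j => Y j ω) n (n - k n + 1) - e n) / c n ≤ x ↔
        U x n ω < (k n - n * G (e n + c n * x)) / √(k n : ℝ)) := by
    intro x
    filter_upwards [hkpos] with n ⟨hn, hkn⟩ ω
    rw [div_le_iff₀ (hc n hn), sub_le_iff_le_add, show x * c n + e n = e n + c n * x by ring,
      orderStat_le_iff _ (hk n hn).1 (hk n hn).2, ← Nat.cast_lt (α := ℝ), card_filter_lt_eq_sum]
    simp only [hU, ← Finset.sum_div, centredExceed, Finset.sum_sub_distrib, Finset.sum_const,
      Finset.card_range, nsmul_eq_mul]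
    rw [div_lt_div_iff_of_pos_right (Real.sqrt_pos.2 hkn)]
    exact (sub_lt_sub_iff_right _).symm
  -- closeness of the two exceedance counts
  have hUV : ∀ x η, 0 < η → Tendsto (fun n => P {ω | η ≤ |U x n ω - V n ω|}) atTop (𝓝 0) := by
    intro x η hη
    -- Chebyshev's bound `n |G (b n) - G (e n + c n * x)| / (η² k)`, rewritten through `n G (b n) =
    -- k` as a convergent factor times `1 / √k`.
    have hlim : Tendsto (fun n : ℕ => ENNReal.ofReal
        (|(k n - n * G (e n + c n * x)) / √(k n : ℝ)| * (√(k n : ℝ))⁻¹ / η ^ 2)) atTop (𝓝 0) := by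
      rw [← ENNReal.ofReal_zero]
      refine ENNReal.tendsto_ofReal ?_
      have := ((hce x).abs.mul (tendsto_inv_atTop_zero.comp hsqrt)).div_const (η ^ 2)
      simpa using this
    refine tendsto_of_tendsto_of_tendsto_of_le_of_le' tendsto_const_nhds hlim
      (Eventually.of_forall fun n => zero_le) ?_
    filter_upwards [hkpos, hb] with n ⟨hn, hkn⟩ hbn
    have hs := Real.sqrt_pos.2 hkn
    have hch := measure_abs_sum_sub_ge_le ν P Y hlaw hindep
      (fun y => J (e n + c n * x) y - J (b n) y)
      (((measurable_const.indicator measurableSet_Ioi)).sub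
        (measurable_const.indicator measurableSet_Ioi)) (1 + 1)
      (fun y => (abs_sub _ _).trans
        (add_le_add (abs_indicator_Ioi_one_le _ _) (abs_indicator_Ioi_one_le _ _))) n
      (η * √(k n : ℝ)) (by positivity)
    rw [integral_sq_sub_indicator_Ioi, integral_sub (integrable_indicator_Ioi_one ν _)
      (integrable_indicator_Ioi_one ν _), integral_indicator_Ioi_one,
      integral_indicator_Ioi_one] at hch
    refine le_trans (le_of_eq ?_) (hch.trans (le_of_eq ?_))
    · congr 1
      ext ω
      have : ∑ j ∈ Finset.range n, (J (e n + c n * x) (Y j ω) - J (b n) (Y j ω) -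
          (G (e n + c n * x) - G (b n))) = (U x n ω - V n ω) * √(k n : ℝ) := by
        simp only [hU, hV, ← Finset.sum_div]
        rw [← sub_div, div_mul_cancel₀ _ hs.ne', ← Finset.sum_sub_distrib]
        refine Finset.sum_congr rfl fun j _ => ?_
        simp only [centredExceed, hJ, hG]
        ring
      simp only [Set.mem_ofPred_eq]
      rw [this, abs_mul, abs_of_pos hs, mul_le_mul_iff_left₀ hs]
    · congr 1
      have h1 : (k n : ℝ) - n * G (e n + c n * x) = n * (G (b n) - G (e n + c n * x)) := by
        rw [mul_sub, hbn]
      rw [h1, abs_div, abs_mul, abs_of_pos hs, abs_sub_comm (G (b n))]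
      simp only [Nat.abs_cast, hG]
      field_simp
  refine tendsto_measure_abs_sub_of_tight P _ V ?_ ?_ ?_ ε hε
  · intro δ hδ
    obtain ⟨r, hr0, hrδ⟩ : ∃ r : ℝ, 0 < r ∧ ENNReal.ofReal r ≤ δ := by
      by_cases h : δ = ⊤
      · exact ⟨1, one_pos, by simp [h]⟩
      · exact ⟨δ.toReal, ENNReal.toReal_pos hδ.ne' h, by rw [ENNReal.ofReal_toReal h]⟩
    have hM : 0 < √(1 / r) := Real.sqrt_pos.2 (by positivity)
    -- Chebyshev gives `P (|V| ≥ M) ≤ n G (b n) / (M² k) = 1 / M²`, which equals `r` for this `M`.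
    refine ⟨√(1 / r), ?_⟩
    filter_upwards [hkpos, hb] with n ⟨hn, hkn⟩ hbn
    have hs := Real.sqrt_pos.2 hkn
    have hch := measure_abs_sum_sub_ge_le ν P Y hlaw hindep (J (b n))
      (measurable_const.indicator measurableSet_Ioi) 1 (abs_indicator_Ioi_one_le _) n
      (√(1 / r) * √(k n : ℝ)) (by positivity)
    have hsq : ∀ y, J (b n) y ^ 2 = J (b n) y := fun y => by
      by_cases h : b n < y <;> simp [hJ, h]
    simp only [hsq] at hch
    rw [integral_indicator_Ioi_one] at hch
    refine le_trans (le_of_eq ?_) ((hch.trans (le_of_eq ?_)).trans hrδ)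
    · congr 1
      ext ω
      have : ∑ j ∈ Finset.range n, (J (b n) (Y j ω) - ν.real (Set.Ioi (b n))) =
          V n ω * √(k n : ℝ) := by
        simp only [hV, ← Finset.sum_div]
        rw [div_mul_cancel₀ _ hs.ne']
        rfl
      simp only [Set.mem_ofPred_eq]
      rw [this, abs_mul, abs_of_pos hs, mul_le_mul_iff_left₀ hs]
    · congr 1
      rw [hbn, mul_pow, Real.sq_sqrt (by positivity), Real.sq_sqrt hkn.le]
      field_simp
  -- `W ≤ x` puts `U` below a threshold that is eventually less than `x + η / 2`, so `V ≥ x + η`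
  -- forces `|U - V| ≥ η / 2`. The other inequality is symmetric.
  · intro x η hη
    refine tendsto_of_tendsto_of_tendsto_of_le_of_le' tendsto_const_nhds
      (hUV x (η / 2) (by positivity)) (Eventually.of_forall fun n => zero_le) ?_
    filter_upwards [hiff x, (hce x).eventually (gt_mem_nhds (show x < x + η / 2 by linarith))]
      with n h1 h2
    refine measure_mono fun ω ⟨hω1, hω2⟩ => ?_
    have := (h1 ω).1 hω1
    rw [Set.mem_ofPred_eq, le_abs]
    right
    simp only [hG] at this
    linarith
  · intro x η hη
    refine tendsto_of_tendsto_of_tendsto_of_le_of_le' tendsto_const_nhds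
      (hUV x (η / 2) (by positivity)) (Eventually.of_forall fun n => zero_le) ?_
    filter_upwards [hiff x, (hce x).eventually (lt_mem_nhds (show x - η / 2 < x by linarith))]
      with n h1 h2
    refine measure_mono fun ω ⟨hω1, hω2⟩ => ?_
    have := mt (h1 ω).2 (not_le.2 hω1)
    rw [Set.mem_ofPred_eq, le_abs]
    left
    simp only [hG] at this
    linarith

/-! ### `D`-norms and the limiting covariances -/

lemma abs_iSup_sub_iSup_le {d : ℕ} (f g : Fin d → ℝ) :
    |(⨆ i, f i) - ⨆ i, g i| ≤ ∑ i, |f i - g i| := by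
  have key : ∀ f g : Fin d → ℝ, (⨆ i, f i) ≤ (⨆ i, g i) + ∑ i, |f i - g i| := by
    intro f g
    rcases isEmpty_or_nonempty (Fin d) with h | h
    · simp
    · refine ciSup_le fun i => ?_
      have h1 : g i ≤ ⨆ i, g i := le_ciSup (Set.finite_range g).bddAbove i
      have h2 : |f i - g i| ≤ ∑ i, |f i - g i| :=
        Finset.single_le_sum (f := fun i => |f i - g i|) (fun i _ => abs_nonneg _)
          (Finset.mem_univ i)
      have h3 := le_abs_self (f i - g i)
      linarith
  rw [abs_sub_le_iff]
  constructor
  · linarith [key f g]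
  · have := key g f
    simp_rw [abs_sub_comm (g _)] at this
    linarith

lemma integrable_iSup_abs_mul {d : ℕ} (ν : Measure (Fin d → ℝ))
    (hint : ∀ i, Integrable (fun z => z i) ν) (x : Fin d → ℝ) :
    Integrable (fun z : Fin d → ℝ => ⨆ i, |x i| * z i) ν := by
  have hm : Measurable (fun z : Fin d → ℝ => ⨆ i, |x i| * z i) :=
    Measurable.iSup fun i => (measurable_pi_apply i).const_mul _
  refine Integrable.mono' (g := fun z => ∑ i, |x i| * |z i|)
    (integrable_finsetSum _ fun i _ => (hint i).abs.const_mul _) hm.aestronglyMeasurable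
    (ae_of_all _ fun z => ?_)
  have := abs_iSup_sub_iSup_le (fun i => |x i| * z i) (fun _ => 0)
  rw [Real.norm_eq_abs]
  simpa [abs_mul] using this

/-- The maximum is Lipschitz in its entries, so `D` is Lipschitz with coordinate constants `E
|Z_i|`. -/
lemma IsDNorm.continuous {d : ℕ} {D : (Fin d → ℝ) → ℝ} (hD : IsDNorm D) : Continuous D := by
  obtain ⟨ν, hν, h0, h1, hDx⟩ := hD
  have hlip : ∀ x y, |D x - D y| ≤ ∑ i, |x i - y i| * ∫ z, |z i| ∂ν := by
    intro x y
    rw [hDx, hDx, ← integral_sub (integrable_iSup_abs_mul ν (fun i => (h1 i).1) x)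
      (integrable_iSup_abs_mul ν (fun i => (h1 i).1) y)]
    have : ∑ i, |x i - y i| * ∫ z, |z i| ∂ν = ∫ z, ∑ i, |x i - y i| * |z i| ∂ν := by
      rw [integral_finsetSum _ fun i _ => (h1 i).1.abs.const_mul _]
      simp_rw [integral_const_mul]
    rw [this, ← Real.norm_eq_abs]
    refine norm_integral_le_of_norm_le
      (integrable_finsetSum _ fun i _ => (h1 i).1.abs.const_mul _) (ae_of_all _ fun z => ?_)
    refine (abs_iSup_sub_iSup_le _ _).trans (Finset.sum_le_sum fun i _ => ?_)
    rw [← sub_mul, abs_mul]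
    exact mul_le_mul_of_nonneg_right (abs_abs_sub_abs_le _ _) (abs_nonneg _)
  rw [continuous_iff_continuousAt]
  intro y
  rw [ContinuousAt, tendsto_iff_norm_sub_tendsto_zero]
  refine squeeze_zero (fun _ => norm_nonneg _) (fun x => hlip x y) ?_
  have : Continuous fun x : Fin d → ℝ => ∑ i, |x i - y i| * ∫ z, |z i| ∂ν := by fun_prop
  simpa using this.tendsto y

lemma IsDNorm.smul_of_nonneg {d : ℕ} {D : (Fin d → ℝ) → ℝ} (hD : IsDNorm D) {r : ℝ} (hr : 0 ≤ r)
    (x : Fin d → ℝ) : D (r • x) = r * D x := by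
  obtain ⟨ν, hν, h0, h1, hDx⟩ := hD
  rw [hDx, hDx, ← integral_const_mul]
  refine integral_congr_ae (ae_of_all _ fun z => ?_)
  simp only
  rw [Real.mul_iSup_of_nonneg hr]
  simp [abs_mul, abs_of_nonneg hr, mul_assoc]

section

variable {d : ℕ}

lemma isProbabilityMeasure_margin (μ : Measure (Fin d → ℝ)) [IsProbabilityMeasure μ] (i : Fin d) :
    IsProbabilityMeasure (μ.map (fun x => x i)) :=
  Measure.isProbabilityMeasure_map (measurable_pi_apply i).aemeasurable

lemma marginCDF_eq (μ : Measure (Fin d → ℝ)) [IsProbabilityMeasure μ] (i : Fin d) (t : ℝ) :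
    marginCDF μ i t = μ.real {x | x i ≤ t} := by
  have := isProbabilityMeasure_margin μ i
  rw [marginCDF, cdf_eq_real, map_measureReal_apply (measurable_pi_apply i) measurableSet_Iic]
  rfl

lemma margin_real_Ioi (μ : Measure (Fin d → ℝ)) [IsProbabilityMeasure μ] (i : Fin d) (t : ℝ) :
    (μ.map (fun x => x i)).real (Set.Ioi t) = 1 - marginCDF μ i t := by
  have := isProbabilityMeasure_margin μ i
  rw [marginCDF, cdf_eq_real, ← Set.compl_Iic, probReal_compl_eq_one_sub measurableSet_Iic]

/-- The joint survival function of two components near the upper endpoints, in terms of the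
`D`-norm. -/
lemma abs_real_joint_exceed_sub_le (μ : Measure (Fin d → ℝ)) [IsProbabilityMeasure μ]
    (C D : (Fin d → ℝ) → ℝ)
    (hSklar : ∀ x : Fin d → ℝ, μ.real (Set.Iic x) = C (fun i => marginCDF μ i (x i)))
    (hD : IsDNorm D) (hexp : HasDNormExpansion C D) (ε : ℝ) (hε : 0 < ε) :
    ∃ r > 0, ∀ i j, i ≠ j → ∀ s t : ℝ, 1 - marginCDF μ i s < r → 1 - marginCDF μ j t < r →
      |μ.real {x | s < x i ∧ t < x j} - ((1 - marginCDF μ i s) + (1 - marginCDF μ j t) -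
        D ((1 - marginCDF μ i s) • Pi.single i (1 : ℝ) +
          (1 - marginCDF μ j t) • Pi.single j (1 : ℝ)))| ≤
      ε * ((1 - marginCDF μ i s) + (1 - marginCDF μ j t)) := by
  have hF0 : ∀ i t, 0 ≤ marginCDF μ i t := fun i t => cdf_nonneg _ _
  have hF1 : ∀ i t, marginCDF μ i t ≤ 1 := fun i t => cdf_le_one _ _
  have h1 := hexp.bound hε
  obtain ⟨r, hr, hball⟩ := Metric.mem_nhdsWithin_iff.1 h1
  refine ⟨r, hr, fun i j hij s t hs ht => ?_⟩
  set p := 1 - marginCDF μ i s with hp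
  set q := 1 - marginCDF μ j t with hq
  have hp0 : 0 ≤ p := sub_nonneg.2 (hF1 _ _)
  have hq0 : 0 ≤ q := sub_nonneg.2 (hF1 _ _)
  -- All coordinates other than `i` and `j` are sent to infinity. The margins there need not reach
  -- `1` at any finite point, so the bivariate estimate is obtained as a limit in `m`.
  set x : ℕ → Fin d → ℝ := fun m l => if l = i then s else if l = j then t else m with hx
  set u : ℕ → Fin d → ℝ := fun m l => marginCDF μ l (x m l) with hu
  set w : Fin d → ℝ := p • Pi.single i (1 : ℝ) + q • Pi.single j (1 : ℝ) with hw
  have hwi : w i = p := by simp [hw, hij]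
  have hwj : w j = q := by simp [hw, hij.symm]
  have hwl : ∀ l, l ≠ i → l ≠ j → w l = 0 := fun l h1 h2 => by simp [hw, h1, h2]
  have hulim : Tendsto (fun m => 1 - u m) atTop (𝓝 w) := by
    rw [tendsto_pi_nhds]
    intro l
    by_cases hli : l = i
    · subst hli
      simp [hu, hx, hwi, hp]
    by_cases hlj : l = j
    · subst hlj
      simp [hu, hx, hwj, hq, hli]
    · rw [hwl l hli hlj]
      have : Tendsto (fun m : ℕ => 1 - marginCDF μ l m) atTop (𝓝 (1 - 1)) :=
        ((tendsto_cdf_atTop _).comp tendsto_natCast_atTop_atTop).const_sub 1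
      simpa [hu, hx, hli, hlj] using this
  have hnorm : ‖w‖ ≤ p + q := by
    rw [pi_norm_le_iff_of_nonneg (by positivity)]
    intro l
    by_cases hli : l = i
    · subst hli
      rw [hwi, Real.norm_of_nonneg hp0]; linarith
    by_cases hlj : l = j
    · subst hlj
      rw [hwj, Real.norm_of_nonneg hq0]; linarith
    · rw [hwl l hli hlj]; simp; positivity
  have hnormr : ‖w‖ < r := by
    rw [pi_norm_lt_iff hr]
    intro l
    by_cases hli : l = i
    · subst hli
      rwa [hwi, Real.norm_of_nonneg hp0]
    by_cases hlj : l = j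
    · subst hlj
      rwa [hwj, Real.norm_of_nonneg hq0]
    · rw [hwl l hli hlj]; simpa using hr
  have hev : ∀ᶠ m in atTop, |μ.real (Set.Iic (x m)) - (1 - D (1 - u m))| ≤ ε * ‖1 - u m‖ := by
    filter_upwards [hulim.norm.eventually (gt_mem_nhds hnormr)] with m hm
    have : u m ∈ Metric.ball 1 r ∩ Set.Icc 0 1 := by
      refine ⟨?_, fun l => hF0 _ _, fun l => hF1 _ _⟩
      rwa [Metric.mem_ball, dist_comm, dist_eq_norm]
    have := hball this
    simp only [Set.mem_ofPred_eq, Real.norm_eq_abs, abs_norm] at this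
    rwa [hSklar]
  have hmeas : Tendsto (fun m => μ.real (Set.Iic (x m))) atTop
      (𝓝 (μ.real {y | y i ≤ s ∧ y j ≤ t})) := by
    have hmono : Monotone fun m => Set.Iic (x m) := by
      intro a b hab
      refine Set.Iic_subset_Iic.2 fun l => ?_
      simp only [hx]
      split_ifs
      · exact le_rfl
      · exact le_rfl
      · exact_mod_cast hab
    have hU : ⋃ m, Set.Iic (x m) = {y | y i ≤ s ∧ y j ≤ t} := by
      ext y
      simp only [Set.mem_iUnion, Set.mem_Iic, Set.mem_ofPred_eq]
      constructor
      · rintro ⟨m, hm⟩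
        have h1 := hm i
        have h2 := hm j
        simp only [hx, if_true, hij.symm, if_false] at h1 h2
        exact ⟨h1, h2⟩
      · rintro ⟨h1, h2⟩
        obtain ⟨m, hm⟩ := exists_nat_ge (∑ l, |y l|)
        refine ⟨m, fun l => ?_⟩
        simp only [hx]
        split_ifs with h3 h4
        · rwa [h3]
        · rwa [h4]
        · exact (le_abs_self _).trans ((Finset.single_le_sum (f := fun l => |y l|)
            (fun _ _ => abs_nonneg _) (Finset.mem_univ l)).trans hm)
    rw [← hU]
    exact (ENNReal.tendsto_toReal (measure_ne_top _ _)).comp (tendsto_measure_iUnion_atTop hmono)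
  have hlim := le_of_tendsto_of_tendsto
    ((hmeas.sub (((hD.continuous.tendsto _).comp hulim).const_sub 1)).abs)
    (hulim.norm.const_mul ε) hev
  have hmi : MeasurableSet {y : Fin d → ℝ | y i ≤ s} :=
    measurableSet_le (measurable_pi_apply i) measurable_const
  have hmj : MeasurableSet {y : Fin d → ℝ | y j ≤ t} :=
    measurableSet_le (measurable_pi_apply j) measurable_const
  -- Inclusion-exclusion; its constant `-1` cancels the `1` of the copula expansion.
  have hincl : μ.real {y | s < y i ∧ t < y j} = p + q - 1 + μ.real {y | y i ≤ s ∧ y j ≤ t} := by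
    have e : {y : Fin d → ℝ | s < y i ∧ t < y j} = ({y | y i ≤ s} ∪ {y | y j ≤ t})ᶜ := by
      ext y; simp
    rw [e, probReal_compl_eq_one_sub (hmi.union hmj)]
    have := measureReal_union_add_inter (μ := μ) (s := {y : Fin d → ℝ | y i ≤ s}) hmj
    rw [hp, hq, marginCDF_eq, marginCDF_eq]
    have e2 : {y : Fin d → ℝ | y i ≤ s} ∩ {y | y j ≤ t} = {y | y i ≤ s ∧ y j ≤ t} := rfl
    rw [e2] at this
    linarith
  rw [hincl]
  refine le_trans (le_of_eq ?_) (hlim.trans (mul_le_mul_of_nonneg_left hnorm hε.le))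
  congr 1
  ring

lemma integral_centredExceed_mul (μ : Measure (Fin d → ℝ)) [IsProbabilityMeasure μ] (i j : Fin d)
    (s t : ℝ) :
    ∫ x, centredExceed (μ.map (fun x => x i)) s (x i) *
      centredExceed (μ.map (fun x => x j)) t (x j) ∂μ =
    μ.real {x | s < x i ∧ t < x j} - (1 - marginCDF μ i s) * (1 - marginCDF μ j t) := by
  have hm : ∀ i s, MeasurableSet {x : Fin d → ℝ | s < x i} := fun i s =>
    measurableSet_lt measurable_const (measurable_pi_apply i)
  have hint : ∀ A : Set (Fin d → ℝ), MeasurableSet A →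
      Integrable (A.indicator fun _ => (1 : ℝ)) μ := fun A hA => (integrable_const _).indicator hA
  have hreal : ∀ i s, μ.real {x : Fin d → ℝ | s < x i} = 1 - marginCDF μ i s := fun i s => by
    rw [marginCDF_eq, ← probReal_compl_eq_one_sub
      (measurableSet_le (measurable_pi_apply i) measurable_const)]
    congr 1
    ext x; simp
  have hI : ∀ A : Set (Fin d → ℝ), MeasurableSet A →
      ∫ x, A.indicator (fun _ => (1 : ℝ)) x ∂μ = μ.real A := fun A hA => by
    rw [integral_indicator hA]; simp
  set p := 1 - marginCDF μ i s
  set q := 1 - marginCDF μ j t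
  have e : ∀ x : Fin d → ℝ, centredExceed (μ.map (fun x => x i)) s (x i) *
      centredExceed (μ.map (fun x => x j)) t (x j) =
      {x : Fin d → ℝ | s < x i ∧ t < x j}.indicator (fun _ => (1 : ℝ)) x -
        q * {x : Fin d → ℝ | s < x i}.indicator (fun _ => (1 : ℝ)) x -
        p * {x : Fin d → ℝ | t < x j}.indicator (fun _ => (1 : ℝ)) x + p * q := by
    intro x
    rw [centredExceed, centredExceed, margin_real_Ioi, margin_real_Ioi]
    by_cases h1 : s < x i <;> by_cases h2 : t < x j <;>
      simp [h1, h2, p, q] <;> ring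
  simp_rw [e]
  have hm2 : MeasurableSet {x : Fin d → ℝ | s < x i ∧ t < x j} := (hm i s).inter (hm j t)
  rw [integral_add, integral_sub, integral_sub, integral_const_mul, integral_const_mul,
    hI _ hm2, hI _ (hm i s), hI _ (hm j t), hreal, hreal]
  · simp [p, q]; ring
  · exact hint _ hm2
  · exact (hint _ (hm i s)).const_mul _
  · exact (hint _ hm2).sub ((hint _ (hm i s)).const_mul _)
  · exact (hint _ (hm j t)).const_mul _
  · exact ((hint _ hm2).sub ((hint _ (hm i s)).const_mul _)).sub ((hint _ (hm j t)).const_mul _)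
  · exact integrable_const _

/-- Turns `n / (√k_i √k_j)` times `k_i / n` into `√(k_i / k_j)`, whose limit is `κ i j`. -/
lemma sqrt_mul_div_eq {a : ℝ} (ha : 0 < a) (b : ℝ) : a / (√a * √b) = √(a / b) := by
  rw [Real.sqrt_div ha.le]
  nth_rewrite 1 [← Real.mul_self_sqrt ha.le]
  exact mul_div_mul_left _ _ (Real.sqrt_pos.2 ha).ne'

/-- Convergence of the covariances of normalized exceedance counts to `asympCov`. -/
theorem tendsto_cov_centredExceed (μ : Measure (Fin d → ℝ)) [IsProbabilityMeasure μ]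
    (C D : (Fin d → ℝ) → ℝ)
    (hSklar : ∀ x : Fin d → ℝ, μ.real (Set.Iic x) = C (fun i => marginCDF μ i (x i)))
    (hD : IsDNorm D) (hexp : HasDNormExpansion C D)
    (k : ℕ → Fin d → ℕ) (hk : ∀ n, 1 ≤ n → ∀ i, 1 ≤ k n i ∧ k n i ≤ n)
    (κ : Fin d → Fin d → ℝ) (hκ : ∀ i j, 0 < κ i j)
    (hratio : ∀ i j, Tendsto (fun n => (k n i : ℝ) / (k n j : ℝ)) atTop (𝓝 (κ i j ^ 2)))
    (hksmall : ∀ i, Tendsto (fun n : ℕ => (k n i : ℝ) / (n : ℝ)) atTop (𝓝 0))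
    (b : ℕ → Fin d → ℝ)
    (hb : ∀ i, ∀ᶠ n : ℕ in atTop, 1 - marginCDF μ i (b n i) = (k n i : ℝ) / n) (i j : Fin d) :
    Tendsto (fun n : ℕ => n * ∫ x,
      (centredExceed (μ.map (fun x => x i)) (b n i) (x i) / √(k n i : ℝ)) *
      (centredExceed (μ.map (fun x => x j)) (b n j) (x j) / √(k n j : ℝ)) ∂μ) atTop
      (𝓝 (asympCov D κ i j)) := by
  have hkpos : ∀ᶠ n : ℕ in atTop, 0 < (n : ℝ) ∧ 0 < (k n i : ℝ) ∧ 0 < (k n j : ℝ) := by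
    filter_upwards [eventually_ge_atTop 1] with n hn
    exact ⟨by exact_mod_cast hn, by exact_mod_cast (hk n hn i).1, by exact_mod_cast (hk n hn j).1⟩
  have hsq : ∀ i j, Tendsto (fun n => √((k n i : ℝ) / (k n j : ℝ))) atTop (𝓝 (κ i j)) := by
    intro i j
    have := (Real.continuous_sqrt.tendsto _).comp (hratio i j)
    rwa [Real.sqrt_sq (hκ i j).le] at this
  have hform : ∀ n : ℕ, n * ∫ x,
      (centredExceed (μ.map (fun x => x i)) (b n i) (x i) / √(k n i : ℝ)) *
      (centredExceed (μ.map (fun x => x j)) (b n j) (x j) / √(k n j : ℝ)) ∂μ =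
      n / (√(k n i : ℝ) * √(k n j : ℝ)) * (μ.real {x | b n i < x i ∧ b n j < x j} -
        (1 - marginCDF μ i (b n i)) * (1 - marginCDF μ j (b n j))) := by
    intro n
    rw [← integral_centredExceed_mul]
    simp_rw [div_mul_div_comm]
    rw [integral_div]
    ring
  simp_rw [hform]
  by_cases hij : i = j
  · subst hij
    -- A binomial variance: `(n / k) p (1 - p) = 1 - k / n` when `p = k / n`.
    have hone : Tendsto (fun n : ℕ => 1 - (k n i : ℝ) / n) atTop (𝓝 (asympCov D κ i i)) := by
      have : asympCov D κ i i = 1 - 0 := by simp [asympCov]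
      rw [this]
      exact (hksmall i).const_sub 1
    refine hone.congr' ?_
    filter_upwards [hkpos, hb i] with n ⟨hn, hki, _⟩ hbi
    have : {x : Fin d → ℝ | b n i < x i ∧ b n i < x i} = {x | x i ≤ b n i}ᶜ := by
      ext x; simp
    rw [this, probReal_compl_eq_one_sub (measurableSet_le (measurable_pi_apply i)
      measurable_const), ← marginCDF_eq, hbi, Real.mul_self_sqrt hki.le]
    field_simp
  · set E : ℕ → ℝ := fun n => μ.real {x | b n i < x i ∧ b n j < x j} -
      ((1 - marginCDF μ i (b n i)) + (1 - marginCDF μ j (b n j)) -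
        D ((1 - marginCDF μ i (b n i)) • Pi.single i (1 : ℝ) +
          (1 - marginCDF μ j (b n j)) • Pi.single j (1 : ℝ))) with hE
    have hEo : Tendsto (fun n => n / (√(k n i : ℝ) * √(k n j : ℝ)) * E n) atTop (𝓝 0) := by
      rw [Metric.tendsto_nhds]
      intro ε hε
      have hB : 0 < κ i j + κ j i + 1 := by linarith [hκ i j, hκ j i]
      -- The scaled remainder is at most `η (√(k_i / k_j) + √(k_j / k_i))`; the bracket is
      -- eventually below `κ i j + κ j i + 1`, leaving `ε / 2`.
      set η := ε / (2 * (κ i j + κ j i + 1)) with hη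
      have hη0 : 0 < η := by positivity
      obtain ⟨r, hr, H⟩ := abs_real_joint_exceed_sub_le μ C D hSklar hD hexp η hη0
      filter_upwards [hkpos, hb i, hb j, (hksmall i).eventually (gt_mem_nhds hr),
        (hksmall j).eventually (gt_mem_nhds hr), ((hsq i j).add (hsq j i)).eventually
        (gt_mem_nhds (lt_add_one _))] with n ⟨hn, hki, hkj⟩ hbi hbj hri hrj hS
      have h := H i j hij (b n i) (b n j) (by rwa [hbi]) (by rwa [hbj])
      change |E n| ≤ _ at h
      rw [hbi, hbj] at h
      have hsi := Real.sqrt_pos.2 hki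
      have hsj := Real.sqrt_pos.2 hkj
      rw [Real.dist_eq, sub_zero, abs_mul, abs_of_pos (by positivity)]
      have e : n / (√(k n i : ℝ) * √(k n j : ℝ)) * (η * ((k n i : ℝ) / n + (k n j : ℝ) / n)) =
          η * (√((k n i : ℝ) / k n j) + √((k n j : ℝ) / k n i)) := by
        rw [← sqrt_mul_div_eq hki _, ← sqrt_mul_div_eq hkj _]
        field_simp
      calc n / (√(k n i : ℝ) * √(k n j : ℝ)) * |E n|
          ≤ n / (√(k n i : ℝ) * √(k n j : ℝ)) * (η * ((k n i : ℝ) / n + (k n j : ℝ) / n)) :=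
            mul_le_mul_of_nonneg_left h (by positivity)
        _ = η * (√((k n i : ℝ) / k n j) + √((k n j : ℝ) / k n i)) := e
        _ ≤ η * (κ i j + κ j i + 1) := mul_le_mul_of_nonneg_left hS.le hη0.le
        _ = ε / 2 := by rw [hη]; field_simp
        _ < ε := by linarith
    -- The product of the means, scaled by `n / √(k_i k_j)`, takes this form and disappears.
    have hpq : Tendsto (fun n : ℕ => √((k n i : ℝ) / n) * √((k n j : ℝ) / n)) atTop (𝓝 0) := by
      have h1 := (Real.continuous_sqrt.tendsto _).comp (hksmall i)
      have h2 := (Real.continuous_sqrt.tendsto _).comp (hksmall j)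
      rw [Real.sqrt_zero] at h1 h2
      simpa using h1.mul h2
    have hDlim : Tendsto (fun n => D (√((k n i : ℝ) / k n j) • Pi.single i (1 : ℝ) +
        √((k n j : ℝ) / k n i) • Pi.single j (1 : ℝ))) atTop
        (𝓝 (D (κ i j • Pi.single i (1 : ℝ) + κ j i • Pi.single j (1 : ℝ)))) :=
      (hD.continuous.tendsto _).comp
        (((hsq i j).smul_const _).add ((hsq j i).smul_const _))
    have hall := (hEo.add (((hsq i j).add (hsq j i)).sub hDlim)).sub hpq
    have hlimeq : 0 + (κ i j + κ j i -
        D (κ i j • Pi.single i (1 : ℝ) + κ j i • Pi.single j (1 : ℝ))) - 0 = asympCov D κ i j := by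
      simp [asympCov, hij]
    rw [hlimeq] at hall
    refine hall.congr' ?_
    filter_upwards [hkpos, hb i, hb j] with n ⟨hn, hki, hkj⟩ hbi hbj
    have hsi := Real.sqrt_pos.2 hki
    have hsj := Real.sqrt_pos.2 hkj
    have hDn : D (√((k n i : ℝ) / k n j) • Pi.single i (1 : ℝ) +
        √((k n j : ℝ) / k n i) • Pi.single j (1 : ℝ)) = n / (√(k n i : ℝ) * √(k n j : ℝ)) *
        D (((k n i : ℝ) / n) • Pi.single i (1 : ℝ) + ((k n j : ℝ) / n) • Pi.single j (1 : ℝ)) := by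
      rw [← hD.smul_of_nonneg (by positivity), smul_add, smul_smul, smul_smul,
        ← sqrt_mul_div_eq hki _, ← sqrt_mul_div_eq hkj _]
      congr 3
      · field_simp
      · field_simp
    rw [hDn]
    simp only [hE, hbi, hbj]
    rw [← sqrt_mul_div_eq hki _, ← sqrt_mul_div_eq hkj _, Real.sqrt_div hki.le,
      Real.sqrt_div hkj.le]
    have hnn : √(n : ℝ) * √(n : ℝ) = n := Real.mul_self_sqrt hn.le
    have hii : √(k n i : ℝ) * √(k n i : ℝ) = k n i := Real.mul_self_sqrt hki.le
    have hjj : √(k n j : ℝ) * √(k n j : ℝ) = k n j := Real.mul_self_sqrt hkj.le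
    have h3 : √(k n i : ℝ) / √(n : ℝ) * (√(k n j : ℝ) / √(n : ℝ)) =
        n / (√(k n i : ℝ) * √(k n j : ℝ)) * ((k n i : ℝ) / n * ((k n j : ℝ) / n)) := by
      have key : ∀ p q N : ℝ, 0 < p → 0 < q → 0 < N →
          p * q / N = N / (p * q) * (p * p / N * (q * q / N)) := by
        intro p q N hp hq hN
        field_simp
      have := key _ _ _ hsi hsj hn
      rw [hii, hjj] at this
      rw [div_mul_div_comm, hnn, this]
    rw [h3]
    field_simp
    ring

/-- A symmetric entrywise limit of covariances is positive semidefinite. -/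
lemma posSemidef_of_tendsto_integral_mul {α : Type*} [MeasurableSpace α] (μ : Measure α)
    (ψ : ℕ → Fin d → α → ℝ)
    (hint : ∀ n i j, Integrable (fun x => ψ n i x * ψ n j x) μ) (S : Matrix (Fin d) (Fin d) ℝ)
    (hv : ∀ i j, Tendsto (fun n : ℕ => n * ∫ x, ψ n i x * ψ n j x ∂μ) atTop (𝓝 (S i j))) :
    S.PosSemidef := by
  refine Matrix.PosSemidef.of_dotProduct_mulVec_nonneg ?_ fun t => ?_
  · ext i j
    simp only [Matrix.conjTranspose_apply, star_trivial]
    refine tendsto_nhds_unique (hv j i) ((hv i j).congr fun n => ?_)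
    simp_rw [mul_comm (ψ n i _)]
  · have : Tendsto (fun n : ℕ => ∑ i, ∑ j, t i * t j * (n * ∫ x, ψ n i x * ψ n j x ∂μ)) atTop
        (𝓝 (∑ i, ∑ j, t i * t j * S i j)) :=
      tendsto_finsetSum _ fun i _ => tendsto_finsetSum _ fun j _ => (hv i j).const_mul _
    rw [star_trivial, dotProduct_mulVec_eq_sum]
    refine ge_of_tendsto' this fun n => ?_
    rw [← mul_integral_sum_sq μ (ψ n) (hint n) t n]
    exact mul_nonneg (Nat.cast_nonneg n) (integral_nonneg fun x => sq_nonneg _)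

end

/-! ### Auxiliary scales and local linearization of the tail -/

lemma leftNhds_top : leftNhds ⊤ = atTop := by
  have : Set.Iio (⊤ : EReal) = {⊤}ᶜ := by ext x; simp [lt_top_iff_ne_top]
  rw [leftNhds, this, EReal.nhdsWithin_top, comap_map EReal.coe_injective]

lemma leftNhds_coe (w : ℝ) : leftNhds (w : EReal) = 𝓝[<] w := by
  rw [leftNhds, nhdsWithin, nhdsWithin, comap_inf, comap_principal,
    ← EReal.isEmbedding_coe.isInducing.nhds_eq_comap]
  congr 2
  ext x
  simp

/-- Every member of `L` contains an order connected member of `L`. -/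
def HasOrdConnectedBasis (L : Filter ℝ) : Prop := ∀ s ∈ L, ∃ t ∈ L, t ⊆ s ∧ t.OrdConnected

lemma hasOrdConnectedBasis_atTop : HasOrdConnectedBasis atTop := fun s hs => by
  obtain ⟨a, ha⟩ := mem_atTop_sets.1 hs
  exact ⟨Set.Ici a, Ici_mem_atTop a, ha, Set.ordConnected_Ici⟩

lemma hasOrdConnectedBasis_nhdsLT (w : ℝ) : HasOrdConnectedBasis (𝓝[<] w) := fun s hs => by
  obtain ⟨a, ha, h⟩ := (mem_nhdsLT_iff_exists_Ioo_subset).1 hs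
  exact ⟨Set.Ioo a w, Ioo_mem_nhdsLT ha, h, Set.ordConnected_Ioo⟩

/-- `g` is an auxiliary scale for `F` along `L`: it is Lipschitz, it is asymptotically proportional
to the reciprocal hazard rate of `F`, and shifts by `o(g)` do not leave `L`. -/
structure IsAuxiliaryScale (F g : ℝ → ℝ) (L : Filter ℝ) (α K : ℝ) : Prop where
  alpha_pos : 0 < α
  lipschitz : ∀ᶠ x in L, DifferentiableAt ℝ g x ∧ |deriv g x| ≤ K
  tendsto_mul_hazard : Tendsto (fun x => g x * (deriv F x / (1 - F x))) L (𝓝 α)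
  shift : ∀ b u : ℕ → ℝ, Tendsto b atTop L → Tendsto u atTop (𝓝 0) →
    Tendsto (fun n => b n + u n * g (b n)) atTop L

/-- The mean value theorem pulled back to `[0, 1]`, so that `b < y`, `y < b` and `b = y` need no
separate treatment. -/
lemma exists_deriv_eq_slope_segment {f : ℝ → ℝ} {T : Set ℝ} (hT : T.OrdConnected)
    (hf : ∀ x ∈ T, DifferentiableAt ℝ f x) {b y : ℝ} (hb : b ∈ T) (hy : y ∈ T) :
    ∃ θ ∈ Set.Icc (0 : ℝ) 1, f y - f b = deriv f (b + θ * (y - b)) * (y - b) := by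
  have hmem : ∀ θ ∈ Set.Icc (0 : ℝ) 1, b + θ * (y - b) ∈ T := by
    intro θ hθ
    have := hT.convex.add_smul_sub_mem hb hy hθ
    simpa using this
  have hd : ∀ θ ∈ Set.Icc (0 : ℝ) 1, HasDerivAt (fun θ => f (b + θ * (y - b)))
      (deriv f (b + θ * (y - b)) * (y - b)) θ := by
    intro θ hθ
    have h1 : HasDerivAt (fun θ : ℝ => b + θ * (y - b)) (y - b) θ := by
      simpa using ((hasDerivAt_id θ).mul_const (y - b)).const_add b
    exact (hf _ (hmem θ hθ)).hasDerivAt.comp θ h1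
  obtain ⟨θ, hθ, h⟩ := exists_hasDerivAt_eq_slope (fun θ => f (b + θ * (y - b)))
    (fun θ => deriv f (b + θ * (y - b)) * (y - b)) zero_lt_one
    (fun θ hθ => (hd θ hθ).continuousAt.continuousWithinAt)
    (fun θ hθ => hd θ (Set.Ioo_subset_Icc_self hθ))
  refine ⟨θ, Set.Ioo_subset_Icc_self hθ, ?_⟩
  rw [h]
  simp

/-- Local linearization of the tail `1 - F` on the scale of the reciprocal hazard rate. -/
theorem tendsto_sqrt_mul_tail_ratio_sub_one {F g : ℝ → ℝ} {L : Filter ℝ} {α K : ℝ}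
    (hL : HasOrdConnectedBasis L)
    (hF : ∀ᶠ x in L, DifferentiableAt ℝ F x ∧ 0 < deriv F x) (hF1 : ∀ᶠ x in L, F x < 1)
    (hg : IsAuxiliaryScale F g L α K) (b s r : ℕ → ℝ) (s₀ : ℝ) (hb : Tendsto b atTop L)
    (hs : Tendsto s atTop (𝓝 s₀)) (hr : Tendsto r atTop atTop) :
    Tendsto (fun n => r n * ((1 - F (b n + s n / r n * ((1 - F (b n)) / deriv F (b n)))) /
      (1 - F (b n)) - 1)) atTop (𝓝 (-s₀)) := by
  have hα := hg.alpha_pos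
  set h : ℝ → ℝ := fun x => deriv F x / (1 - F x) with hh
  have hgood : ∀ᶠ x in L, (DifferentiableAt ℝ F x ∧ 0 < deriv F x) ∧ F x < 1 ∧
      (DifferentiableAt ℝ g x ∧ |deriv g x| ≤ K) ∧ 0 < g x * h x :=
    hF.and (hF1.and (hg.lipschitz.and (hg.tendsto_mul_hazard.eventually (lt_mem_nhds hα))))
  obtain ⟨T, hTL, hTg, hT⟩ := hL _ hgood
  have hhpos : ∀ x ∈ T, 0 < h x := fun x hx =>
    div_pos (hTg hx).1.2 (sub_pos.2 (hTg hx).2.1)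
  have hgpos : ∀ x ∈ T, 0 < g x := fun x hx =>
    pos_of_mul_pos_left (hTg hx).2.2.2 (hhpos x hx).le
  set y : ℕ → ℝ := fun n => b n + s n / r n * ((1 - F (b n)) / deriv F (b n)) with hy
  have hbT : ∀ᶠ n in atTop, b n ∈ T := hb hTL
  have hsr : Tendsto (fun n => s n / r n) atTop (𝓝 0) := hs.div_atTop hr
  have hgh : Tendsto (fun n => g (b n) * h (b n)) atTop (𝓝 α) := hg.tendsto_mul_hazard.comp hb
  -- Chosen so that the increment `(s / r) / h(b)` equals `u g(b)` with `u → 0`, an admissible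
  -- shift.
  set u : ℕ → ℝ := fun n => s n / r n / (g (b n) * h (b n)) with hu
  have hu0 : Tendsto u atTop (𝓝 0) := by
    have := hsr.div hgh hα.ne'
    rwa [zero_div] at this
  have hyb : ∀ᶠ n in atTop, y n - b n = u n * g (b n) := by
    filter_upwards [hbT] with n hn
    have h1 := hgpos _ hn
    have h2 := (hTg hn).1.2
    have h3 : 0 < 1 - F (b n) := sub_pos.2 (hTg hn).2.1
    simp only [hy, hu, hh]
    field_simp
    ring
  have hyL : Tendsto y atTop L := by
    refine (hg.shift b u hb hu0).congr' ?_
    filter_upwards [hyb] with n hn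
    rw [← hn]; ring
  have hyT : ∀ᶠ n in atTop, y n ∈ T := hyL hTL
  have hlog : ∀ x ∈ T, HasDerivAt (fun x => Real.log (1 - F x)) (-h x) x := by
    intro x hx
    have h3 : 0 < 1 - F x := sub_pos.2 (hTg hx).2.1
    have := ((hTg hx).1.1.hasDerivAt.const_sub 1).log h3.ne'
    rwa [neg_div] at this
  have hmvt : ∀ᶠ n in atTop, ∃ θ : ℝ, θ ∈ Set.Icc (0 : ℝ) 1 ∧ b n + θ * (y n - b n) ∈ T ∧
      Real.log (1 - F (y n)) - Real.log (1 - F (b n)) =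
        -h (b n + θ * (y n - b n)) * (y n - b n) := by
    filter_upwards [hbT, hyT] with n h1 h2
    obtain ⟨θ, hθ, e⟩ := exists_deriv_eq_slope_segment hT
      (fun x hx => (hlog x hx).differentiableAt) h1 h2
    have hm : b n + θ * (y n - b n) ∈ T := by
      simpa using hT.convex.add_smul_sub_mem h1 h2 hθ
    exact ⟨θ, hθ, hm, by rw [e, (hlog _ hm).deriv]⟩
  obtain ⟨θ, hθ⟩ := hmvt.choice
  set ζ : ℕ → ℝ := fun n => b n + θ n * (y n - b n) with hζ
  have hv0 : Tendsto (fun n => θ n * u n) atTop (𝓝 0) := by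
    refine squeeze_zero_norm' ?_ (by simpa using hu0.norm)
    filter_upwards [hθ] with n hn
    rw [norm_mul, Real.norm_of_nonneg hn.1.1]
    exact mul_le_of_le_one_left (norm_nonneg _) hn.1.2
  have hζb : ∀ᶠ n in atTop, ζ n - b n = θ n * u n * g (b n) := by
    filter_upwards [hyb] with n hn
    simp only [hζ]
    rw [hn]; ring
  have hζL : Tendsto ζ atTop L := by
    refine (hg.shift b _ hb hv0).congr' ?_
    filter_upwards [hζb] with n hn
    rw [← hn]; ring
  have hgh' : Tendsto (fun n => g (ζ n) * h (ζ n)) atTop (𝓝 α) := hg.tendsto_mul_hazard.comp hζL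
  -- The Lipschitz bound gives `|g(ζ) - g(b)| ≤ K |θ u| g(b)`. As `g h` has a nonzero limit, the
  -- same comparison then passes to `h`.
  have hgratio : Tendsto (fun n => g (ζ n) / g (b n)) atTop (𝓝 1) := by
    rw [tendsto_iff_norm_sub_tendsto_zero]
    refine squeeze_zero' (Eventually.of_forall fun _ => norm_nonneg _) ?_
      (by simpa using hv0.norm.const_mul K)
    filter_upwards [hbT, hθ, hζb] with n h1 h2 h3
    have hpos := hgpos _ h1
    have := hT.convex.norm_image_sub_le_of_norm_deriv_le (f := g) (C := K)
      (fun x hx => (hTg hx).2.2.1.1) (fun x hx => (hTg hx).2.2.1.2) h1 h2.2.1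
    change ‖g (ζ n) - g (b n)‖ ≤ K * ‖ζ n - b n‖ at this
    rw [h3, norm_mul, Real.norm_of_nonneg hpos.le] at this
    rw [div_sub_one hpos.ne', norm_div, Real.norm_of_nonneg hpos.le, div_le_iff₀ hpos,
      mul_assoc]
    rw [norm_mul] at this
    exact this
  have hhratio : Tendsto (fun n => h (ζ n) / h (b n)) atTop (𝓝 1) := by
    have := (hgh'.div hgh hα.ne').div hgratio one_ne_zero
    rw [div_self hα.ne', div_one] at this
    refine this.congr' ?_
    filter_upwards [hbT, hζL hTL] with n h1 h2
    have e1 := hgpos _ h1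
    have e2 := hgpos _ h2
    have e3 := hhpos _ h1
    simp only [Pi.div_apply]
    field_simp
  set z : ℕ → ℝ := fun n => Real.log (1 - F (y n)) - Real.log (1 - F (b n)) with hz
  have hrz : Tendsto (fun n => r n * z n) atTop (𝓝 (-s₀)) := by
    have := (hhratio.mul hs).neg
    rw [one_mul] at this
    refine this.congr' ?_
    filter_upwards [hbT, hθ, hr.eventually_gt_atTop 0] with n h1 h2 h3
    simp only [hz]
    rw [h2.2.2]
    have e2 := (hTg h1).1.2
    have e3 : 0 < 1 - F (b n) := sub_pos.2 (hTg h1).2.1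
    have e : y n - b n = s n / r n * ((1 - F (b n)) / deriv F (b n)) := by
      simp only [hy]; ring
    change _ = r n * (-h (ζ n) * (y n - b n))
    rw [e]
    have : h (b n) = deriv F (b n) / (1 - F (b n)) := rfl
    rw [this]
    field_simp
  have hz0 : Tendsto z atTop (𝓝 0) := by
    refine (hrz.div_atTop hr).congr' ?_
    filter_upwards [hr.eventually_gt_atTop 0] with n h3
    field_simp
  -- Passing from the logarithm of the tail ratio to the ratio costs at most `r z² = (r z) z → 0`.
  have hrem : Tendsto (fun n => r n * (Real.exp (z n) - 1 - z n)) atTop (𝓝 0) := by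
    have hlim : Tendsto (fun n => |r n * z n| * |z n|) atTop (𝓝 0) := by
      simpa using hrz.abs.mul hz0.abs
    refine squeeze_zero_norm' ?_ hlim
    have : ∀ᶠ n in atTop, |z n| ≤ 1 := by
      have := hz0.abs
      rw [abs_zero] at this
      exact this.eventually (ge_mem_nhds zero_lt_one)
    filter_upwards [this] with n hn
    have := Real.abs_exp_sub_one_sub_id_le hn
    rw [norm_mul, abs_mul, mul_assoc]
    refine mul_le_mul_of_nonneg_left ?_ (norm_nonneg _)
    rw [Real.norm_eq_abs]
    refine this.trans (le_of_eq ?_)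
    rw [← sq, sq_abs]
  have hfin := hrem.add hrz
  rw [zero_add] at hfin
  refine hfin.congr' ?_
  filter_upwards [hbT, hyT] with n h1 h2
  have e1 : 0 < 1 - F (y n) := sub_pos.2 (hTg h2).2.1
  have e3 : 0 < 1 - F (b n) := sub_pos.2 (hTg h1).2.1
  have : Real.exp (z n) = (1 - F (y n)) / (1 - F (b n)) := by
    simp only [hz]
    rw [Real.exp_sub, Real.exp_log e1, Real.exp_log e3]
  rw [this]
  ring

/-! ### Quantiles near the upper endpoint and stability under shifts -/

/-- Quantiles of a distribution function which is continuous near the end `L` of its support. -/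
theorem tendsto_genInv {F : ℝ → ℝ} {L : Filter ℝ} [L.NeBot] (hL : HasOrdConnectedBasis L)
    (hmono : Monotone F)
    (hright : ∀ x, ContinuousWithinAt F (Set.Ici x) x) (hcont : ∀ᶠ x in L, ContinuousAt F x)
    (hF1 : ∀ᶠ x in L, F x < 1) (hone : Tendsto F L (𝓝 1)) (u : ℕ → ℝ)
    (hu : Tendsto u atTop (𝓝 1)) (hu1 : ∀ᶠ n in atTop, u n < 1) :
    Tendsto (fun n => genInv F (u n)) atTop L ∧ ∀ᶠ n in atTop, F (genInv F (u n)) = u n := by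
  have key : ∀ s ∈ L, ∀ᶠ n in atTop, genInv F (u n) ∈ s ∧ F (genInv F (u n)) = u n := by
    intro s hs
    obtain ⟨T, hTL, hTs, hT⟩ := hL _ (hcont.and (hF1.and hs))
    obtain ⟨x₁, hx₁⟩ := nonempty_of_mem hTL
    filter_upwards [hu1, hu.eventually (lt_mem_nhds (hTs hx₁).2.1)] with n h1 h2
    obtain ⟨x₂, hx₂⟩ := nonempty_of_mem
      (inter_mem hTL (hone.eventually (lt_mem_nhds h1)))
    have h4 : u n < F x₂ := hx₂.2
    have h12 : x₁ ≤ x₂ := by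
      by_contra h
      have := hmono (le_of_not_ge h)
      linarith
    set A := {t : ℝ | u n ≤ F t} with hA
    have hAne : A.Nonempty := ⟨x₂, h4.le⟩
    have hAlow : ∀ t ∈ A, x₁ ≤ t := by
      intro t ht
      by_contra h
      have := hmono (le_of_not_ge h)
      have : u n ≤ F t := ht
      linarith
    have hAb : BddBelow A := ⟨x₁, hAlow⟩
    obtain ⟨x, hx, hFx⟩ := intermediate_value_Icc h12
      (fun x hx => (hTs (hT.out hx₁ hx₂.1 hx)).1.continuousWithinAt) ⟨h2.le, h4.le⟩
    have hle : sInf A ≤ x := csInf_le hAb hFx.ge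
    have hge : x₁ ≤ sInf A := le_csInf hAne hAlow
    -- Right continuity gives `≥` at the infimum; the intermediate value point `x` gives `≤`.
    have hmem : u n ≤ F (sInf A) := by
      have hr : Tendsto F (𝓝[>] (sInf A)) (𝓝 (F (sInf A))) :=
        (hright (sInf A)).mono_left (nhdsWithin_mono _ Set.Ioi_subset_Ici_self)
      refine ge_of_tendsto hr ?_
      filter_upwards [self_mem_nhdsWithin] with t ht
      obtain ⟨a, ha, hat⟩ := exists_lt_of_csInf_lt hAne ht
      exact le_trans ha (hmono hat.le)
    refine ⟨(hTs (hT.out hx₁ hx₂.1 ⟨hge, hle.trans hx.2⟩)).2.2, le_antisymm ?_ hmem⟩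
    calc F (sInf A) ≤ F x := hmono hle
      _ = u n := hFx
  exact ⟨fun s hs => (key s hs).mono fun n h => h.1, (key _ univ_mem).mono fun n h => h.2⟩

/-- At most linear growth of `g` gives the lower bound `(1 - |u| M) b` for the shifted point. -/
lemma tendsto_shift_atTop {g : ℝ → ℝ} {M : ℝ}
    (hg : ∀ᶠ x in atTop, |g x| ≤ M * x) (b u : ℕ → ℝ) (hb : Tendsto b atTop atTop)
    (hu : Tendsto u atTop (𝓝 0)) : Tendsto (fun n => b n + u n * g (b n)) atTop atTop := by
  have hMu : Tendsto (fun n => 1 - |u n| * M) atTop (𝓝 1) := by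
    simpa using (hu.abs.mul_const M).const_sub 1
  refine tendsto_atTop_mono' _ ?_ (hMu.pos_mul_atTop one_pos hb)
  filter_upwards [hb.eventually hg] with n hn
  have h1 : |u n * g (b n)| ≤ |u n| * (M * b n) := by
    rw [abs_mul]; exact mul_le_mul_of_nonneg_left hn (abs_nonneg _)
  have := neg_abs_le (u n * g (b n))
  linarith

/-- The shift is at most `|u| M (w - b)`, eventually less than the distance from `b` to `w`. -/
lemma tendsto_shift_nhdsLT {g : ℝ → ℝ} {M w : ℝ}
    (hg : ∀ᶠ x in 𝓝[<] w, |g x| ≤ M * (w - x)) (b u : ℕ → ℝ) (hb : Tendsto b atTop (𝓝[<] w))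
    (hu : Tendsto u atTop (𝓝 0)) : Tendsto (fun n => b n + u n * g (b n)) atTop (𝓝[<] w) := by
  have hb' := tendsto_nhdsWithin_iff.1 hb
  have hMu : Tendsto (fun n => |u n| * M) atTop (𝓝 0) := by simpa using hu.abs.mul_const M
  have hbd : ∀ᶠ n in atTop, |u n * g (b n)| ≤ |u n| * M * (w - b n) := by
    filter_upwards [hb.eventually hg] with n hn
    rw [abs_mul, mul_assoc]
    exact mul_le_mul_of_nonneg_left hn (abs_nonneg _)
  refine tendsto_nhdsWithin_iff.2 ⟨?_, ?_⟩
  · have h0 : Tendsto (fun n => u n * g (b n)) atTop (𝓝 0) := by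
      refine squeeze_zero_norm' hbd ?_
      simpa using hMu.mul (hb'.1.const_sub w)
    simpa using hb'.1.add h0
  · filter_upwards [hbd, hb'.2, hMu.eventually (gt_mem_nhds one_pos)] with n h1 h2 h3
    have h2 : 0 < w - b n := sub_pos.2 h2
    have := le_abs_self (u n * g (b n))
    have := mul_lt_mul_of_pos_right h3 h2
    change _ < w
    linarith

/-- The tail vanishes at a finite endpoint if the hazard rate is at least of order `1 / (w - x)`. -/
lemma tendsto_one_of_hazard {F g : ℝ → ℝ} {w α M : ℝ} (hα : 0 < α)
    (hF : ∀ᶠ x in 𝓝[<] w, DifferentiableAt ℝ F x) (hF1 : ∀ᶠ x in 𝓝[<] w, F x < 1)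
    (hFd : ∀ᶠ x in 𝓝[<] w, 0 < deriv F x)
    (hgM : ∀ᶠ x in 𝓝[<] w, |g x| ≤ M * (w - x))
    (hlim : Tendsto (fun x => g x * (deriv F x / (1 - F x))) (𝓝[<] w) (𝓝 α)) :
    Tendsto F (𝓝[<] w) (𝓝 1) := by
  -- From `g h > α / 2` and `g ≤ (|M| + 1) (w - x)` one gets `h ≥ β / (w - x)`. Integrated, this
  -- bounds `log (1 - F)` by a constant plus `β log (w - x)`, which excludes an atom at `w`.
  set β := α / (2 * (|M| + 1)) with hβ
  have hβ0 : 0 < β := by positivity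
  obtain ⟨T, hTL, hTg, hT⟩ := hasOrdConnectedBasis_nhdsLT w _ (hF.and (hF1.and (hFd.and (hgM.and
    ((hlim.eventually (lt_mem_nhds (half_lt_self hα))).and
      (self_mem_nhdsWithin : ∀ᶠ x in 𝓝[<] w, x ∈ Set.Iio w))))))
  have hbound : ∀ x ∈ T, β / (w - x) ≤ deriv F x / (1 - F x) := by
    intro x hx
    obtain ⟨-, h2, h3, h4, h5, h6⟩ := hTg hx
    have h6 : 0 < w - x := sub_pos.2 h6
    have hh : 0 < deriv F x / (1 - F x) := div_pos h3 (sub_pos.2 h2)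
    rw [div_le_iff₀ h6, hβ, div_le_iff₀ (by positivity)]
    have e1 : g x * (deriv F x / (1 - F x)) ≤
        (|M| + 1) * (w - x) * (deriv F x / (1 - F x)) := by
      refine mul_le_mul_of_nonneg_right ((le_abs_self _).trans (h4.trans ?_)) hh.le
      exact mul_le_mul_of_nonneg_right (by linarith [le_abs_self M]) h6.le
    linarith
  set φ : ℝ → ℝ := fun x => Real.log (1 - F x) - β * Real.log (w - x) with hφ
  have hφd : ∀ x ∈ T, HasDerivAt φ (-(deriv F x / (1 - F x)) + β / (w - x)) x := by
    intro x hx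
    obtain ⟨h1, h2, -, -, -, h6⟩ := hTg hx
    have h6 : 0 < w - x := sub_pos.2 h6
    have d1 := (h1.hasDerivAt.const_sub 1).log (sub_pos.2 h2).ne'
    have d2 := (((hasDerivAt_id x).const_sub w).log h6.ne').const_mul β
    refine (d1.sub d2).congr_deriv ?_
    simp only [id]
    ring
  have hanti : AntitoneOn φ T := by
    refine antitoneOn_of_deriv_nonpos hT.convex
      (fun x hx => (hφd x hx).continuousAt.continuousWithinAt)
      (fun x hx => (hφd x (interior_subset hx)).differentiableAt.differentiableWithinAt)
      fun x hx => ?_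
    rw [(hφd x (interior_subset hx)).deriv]
    linarith [hbound x (interior_subset hx)]
  obtain ⟨x₀, hx₀⟩ := nonempty_of_mem hTL
  have hwx : Tendsto (fun x => w - x) (𝓝[<] w) (𝓝[>] 0) := by
    refine tendsto_nhdsWithin_iff.2 ⟨?_, ?_⟩
    · have : Tendsto (fun x => w - x) (𝓝 w) (𝓝 (w - w)) := tendsto_id.const_sub w
      rw [sub_self] at this
      exact this.mono_left nhdsWithin_le_nhds
    · filter_upwards [self_mem_nhdsWithin] with x hx
      exact sub_pos.2 (show x < w from hx)
  have hlogbot : Tendsto (fun x => φ x₀ + β * Real.log (w - x)) (𝓝[<] w) atBot :=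
    tendsto_atBot_add_const_left _ _ ((Real.tendsto_log_nhdsGT_zero.comp hwx).const_mul_atBot hβ0)
  have hlogF : Tendsto (fun x => Real.log (1 - F x)) (𝓝[<] w) atBot := by
    refine tendsto_atBot_mono' _ ?_ hlogbot
    filter_upwards [hTL, Ioo_mem_nhdsLT (hTg hx₀).2.2.2.2.2] with x hx hx2
    have := hanti hx₀ hx hx2.1.le
    simp only [hφ] at this ⊢
    linarith
  have hexp := Real.tendsto_exp_atBot.comp hlogF
  have := hexp.const_sub 1
  rw [sub_zero] at this
  refine this.congr' ?_
  filter_upwards [hF1] with x hx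
  simp only [Function.comp_apply]
  rw [Real.exp_log (sub_pos.2 hx)]
  ring

/-! ### Auxiliary scales from the von Mises conditions -/

/-- The integrated tail occurring in the first von Mises condition. -/
noncomputable def integratedTail (F : ℝ → ℝ) (x : ℝ) : ℝ :=
  ∫ t in {t : ℝ | x < t ∧ (t : EReal) < upperEndpoint F}, (1 - F t)

/-- Near `x` the integrated tail is a constant minus an integral with moving upper limit, so the
fundamental theorem of calculus applies. The base point `x - 1` is arbitrary. -/
lemma hasDerivAt_integratedTail {F : ℝ → ℝ}
    (hint : ∀ x : ℝ, IntegrableOn (fun t => 1 - F t)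
      {t : ℝ | x < t ∧ (t : EReal) < upperEndpoint F})
    (hm : Measurable F) {x : ℝ} (hx : (x : EReal) < upperEndpoint F) (hc : ContinuousAt F x) :
    HasDerivAt (integratedTail F) (-(1 - F x)) x := by
  set S : ℝ → Set ℝ := fun x => {t : ℝ | x < t ∧ (t : EReal) < upperEndpoint F} with hS
  have hSm : ∀ x, MeasurableSet (S x) := fun x =>
    measurableSet_Ioi.inter (measurable_coe_real_ereal measurableSet_Iio)
  have hsplit : ∀ y : ℝ, x - 1 < y → (y : EReal) < upperEndpoint F →
      integratedTail F y = integratedTail F (x - 1) - ∫ t in (x - 1)..y, (1 - F t) := by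
    intro y hy1 hy2
    have hU : S (x - 1) = Set.Ioc (x - 1) y ∪ S y := by
      ext t
      simp only [hS, Set.mem_ofPred_eq, Set.mem_union, Set.mem_Ioc]
      constructor
      · rintro ⟨h1, h2⟩
        rcases le_or_gt t y with h | h
        · exact Or.inl ⟨h1, h⟩
        · exact Or.inr ⟨h, h2⟩
      · rintro (⟨h1, h2⟩ | ⟨h1, h2⟩)
        · exact ⟨h1, lt_of_le_of_lt (EReal.coe_le_coe_iff.2 h2) hy2⟩
        · exact ⟨hy1.trans h1, h2⟩
    have hdisj : Disjoint (Set.Ioc (x - 1) y) (S y) := by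
      rw [Set.disjoint_left]
      rintro t ⟨-, h1⟩ ⟨h2, -⟩
      exact absurd h2 (not_lt.2 h1)
    have hsub : Set.Ioc (x - 1) y ⊆ S (x - 1) := by rw [hU]; exact Set.subset_union_left
    have := setIntegral_union hdisj (hSm y) ((hint (x - 1)).mono_set hsub) (hint y)
    rw [← hU] at this
    rw [intervalIntegral.integral_of_le hy1.le]
    simp only [integratedTail]
    change _ = (∫ t in S (x - 1), (1 - F t)) - _
    rw [this]
    ring_nf
    rfl
  have hd : HasDerivAt (fun y => integratedTail F (x - 1) - ∫ t in (x - 1)..y, (1 - F t))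
      (-(1 - F x)) x := by
    refine HasDerivAt.const_sub _ ?_
    refine intervalIntegral.integral_hasDerivAt_right ?_ ?_ (continuousAt_const.sub hc)
    · rw [intervalIntegrable_iff_integrableOn_Ioc_of_le (by linarith)]
      refine (hint (x - 1)).mono_set fun t ht => ⟨ht.1, ?_⟩
      exact lt_of_le_of_lt (EReal.coe_le_coe_iff.2 ht.2) hx
    · exact (measurable_const.sub hm).stronglyMeasurable.stronglyMeasurableAtFilter
  refine hd.congr_of_eventuallyEq ?_
  have h1 : ∀ᶠ y : ℝ in 𝓝 x, x - 1 < y := lt_mem_nhds (by linarith)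
  have h2 : ∀ᶠ y : ℝ in 𝓝 x, (y : EReal) < upperEndpoint F :=
    (continuous_coe_real_ereal.tendsto x).eventually (gt_mem_nhds hx)
  filter_upwards [h1, h2] with y h1 h2
  exact hsplit y h1 h2

lemma upperEndpoint_ne_bot {F : ℝ → ℝ} (hbot : Tendsto F atBot (𝓝 0)) : upperEndpoint F ≠ ⊥ := by
  obtain ⟨x, hx⟩ := (hbot.eventually (gt_mem_nhds zero_lt_one)).exists
  have : (x : EReal) ≤ upperEndpoint F := le_sSup ⟨x, hx, rfl⟩
  intro h
  rw [h] at this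
  exact absurd (EReal.bot_lt_coe x) (not_lt.2 this)

lemma lt_one_of_lt_upperEndpoint {F : ℝ → ℝ} (hmono : Monotone F) {x : ℝ}
    (hx : (x : EReal) < upperEndpoint F) : F x < 1 := by
  obtain ⟨_, ⟨y, hy, rfl⟩, hxy⟩ := lt_sSup_iff.1 hx
  exact (hmono (EReal.coe_lt_coe_iff.1 hxy).le).trans_lt hy

lemma eventually_lt_upperEndpoint (F : ℝ → ℝ) :
    ∀ᶠ x : ℝ in leftNhds (upperEndpoint F), (x : EReal) < upperEndpoint F :=
  (eventually_mem_nhdsWithin (s := Set.Iio (upperEndpoint F))).comap _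

/-- The mean excess function is an auxiliary scale under the first von Mises condition. -/
lemma deriv_meanExcess_tendsto {F : ℝ → ℝ} (hmono : Monotone F)
    (hderiv : HasPosDerivNearEndpoint F) (hvM : VonMises1 F) :
    (∀ᶠ x in leftNhds (upperEndpoint F),
      DifferentiableAt ℝ (fun x => integratedTail F x / (1 - F x)) x ∧
      |deriv (fun x => integratedTail F x / (1 - F x)) x| ≤ 1) ∧
    Tendsto (fun x => integratedTail F x / (1 - F x) * (deriv F x / (1 - F x)))
      (leftNhds (upperEndpoint F)) (𝓝 1) := by
  have hlim : Tendsto (fun x => integratedTail F x / (1 - F x) * (deriv F x / (1 - F x)))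
      (leftNhds (upperEndpoint F)) (𝓝 1) := by
    refine hvM.2.congr fun x => ?_
    simp only [integratedTail]
    rw [div_mul_div_comm, sq, mul_comm (deriv F x)]
  refine ⟨?_, hlim⟩
  -- The mean excess function `g` has derivative `g h - 1`, which tends to `0`; hence the Lipschitz
  -- constant `1`.
  have habs : ∀ᶠ x in leftNhds (upperEndpoint F),
      |integratedTail F x / (1 - F x) * (deriv F x / (1 - F x)) - 1| < 1 := by
    have := (hlim.sub_const 1).abs
    rw [sub_self, abs_zero] at this
    exact this.eventually (gt_mem_nhds one_pos)
  filter_upwards [hderiv, eventually_lt_upperEndpoint F, habs] with x h1 h2 h3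
  have hpos : 0 < 1 - F x := sub_pos.2 (lt_one_of_lt_upperEndpoint hmono h2)
  have d := (hasDerivAt_integratedTail hvM.1 hmono.measurable h2 h1.1.continuousAt).div
    (h1.1.hasDerivAt.const_sub 1) hpos.ne'
  have d' : HasDerivAt (fun x => integratedTail F x / (1 - F x))
      (integratedTail F x / (1 - F x) * (deriv F x / (1 - F x)) - 1) x := by
    refine d.congr_deriv ?_
    field_simp
    ring
  exact ⟨d'.differentiableAt, by rw [d'.deriv]; exact h3.le⟩

/-- The scale is the mean excess function, `x` or `w - x`. Shift stability needs `|g|` to be of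
order at most `x` or `w - x`. That `F` tends to `1` is automatic at an infinite endpoint and comes
from the hazard rate at a finite one. -/
lemma exists_isAuxiliaryScale {F : ℝ → ℝ} (hmono : Monotone F)
    (hbot : Tendsto F atBot (𝓝 0)) (htop : Tendsto F atTop (𝓝 1))
    (hderiv : HasPosDerivNearEndpoint F)
    (hvM : VonMises1 F ∨ VonMises2 F ∨ VonMises3 F) :
    (leftNhds (upperEndpoint F)).NeBot ∧ HasOrdConnectedBasis (leftNhds (upperEndpoint F)) ∧
    Tendsto F (leftNhds (upperEndpoint F)) (𝓝 1) ∧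
    ∃ g α K, IsAuxiliaryScale F g (leftNhds (upperEndpoint F)) α K := by
  have hlt : ∀ᶠ x in leftNhds (upperEndpoint F), F x < 1 :=
    (eventually_lt_upperEndpoint F).mono fun x hx => lt_one_of_lt_upperEndpoint hmono hx
  have hd := hderiv
  rw [HasPosDerivNearEndpoint] at hd
  rcases hw : upperEndpoint F with _ | _ | w
  · exact absurd hw (upperEndpoint_ne_bot hbot)
  · change upperEndpoint F = ⊤ at hw
    change (leftNhds ⊤).NeBot ∧ HasOrdConnectedBasis (leftNhds ⊤) ∧ Tendsto F (leftNhds ⊤) (𝓝 1) ∧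
      ∃ g α K, IsAuxiliaryScale F g (leftNhds ⊤) α K
    rw [leftNhds_top]
    refine ⟨inferInstance, hasOrdConnectedBasis_atTop, htop, ?_⟩
    rcases hvM with h | h | h
    · obtain ⟨h1, h2⟩ := deriv_meanExcess_tendsto hmono hderiv h
      rw [hw, leftNhds_top] at h1 h2
      refine ⟨_, 1, 1, one_pos, h1, h2, fun b u hb hu => tendsto_shift_atTop
        (g := fun x => integratedTail F x / (1 - F x)) (M := 2) ?_ b u hb hu⟩
      set g : ℝ → ℝ := fun x => integratedTail F x / (1 - F x) with hg
      -- The Lipschitz bound gives `|g x| ≤ |g a| + x - a`, and this is at most `2 x` once `x ≥ |g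
      -- a| + |a|`.
      obtain ⟨a, ha⟩ := eventually_atTop.1 h1
      filter_upwards [eventually_ge_atTop a, eventually_ge_atTop (|g a| + |a|)] with x hx hx2
      have := (convex_Ici a).norm_image_sub_le_of_norm_deriv_le (f := g) (C := 1)
        (fun y hy => (ha y hy).1) (fun y hy => (ha y hy).2) Set.self_mem_Ici hx
      rw [one_mul, Real.norm_eq_abs, Real.norm_eq_abs, abs_of_nonneg (sub_nonneg.2 hx)] at this
      have e := abs_sub_abs_le_abs_sub (g x) (g a)
      have e2 := neg_abs_le a
      linarith
    · obtain ⟨-, α, hα, h⟩ := h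
      refine ⟨id, α, 1, hα, Eventually.of_forall fun x => ⟨differentiableAt_id, by simp⟩, ?_,
        fun b u hb hu => tendsto_shift_atTop (M := 1) ?_ b u hb hu⟩
      · refine h.congr fun x => ?_
        simp [mul_div_assoc]
      · filter_upwards [eventually_ge_atTop 0] with x hx
        simp [abs_of_nonneg hx]
    · obtain ⟨w, hw', -⟩ := h
      rw [hw] at hw'
      exact absurd hw' (EReal.coe_ne_top w).symm
  · change upperEndpoint F = (w : EReal) at hw
    change (leftNhds (w : EReal)).NeBot ∧ HasOrdConnectedBasis (leftNhds (w : EReal)) ∧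
      Tendsto F (leftNhds (w : EReal)) (𝓝 1) ∧
      ∃ g α K, IsAuxiliaryScale F g (leftNhds (w : EReal)) α K
    rw [hw, leftNhds_coe] at hd hlt
    rw [leftNhds_coe]
    suffices H : ∃ g α K M, 0 < α ∧ (∀ᶠ x in 𝓝[<] w, DifferentiableAt ℝ g x ∧ |deriv g x| ≤ K) ∧
        Tendsto (fun x => g x * (deriv F x / (1 - F x))) (𝓝[<] w) (𝓝 α) ∧
        ∀ᶠ x in 𝓝[<] w, |g x| ≤ M * (w - x) by
      obtain ⟨g, α, K, M, hα, h1, h2, h3⟩ := H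
      exact ⟨inferInstance, hasOrdConnectedBasis_nhdsLT w,
        tendsto_one_of_hazard hα (hd.mono fun _ h => h.1) hlt (hd.mono fun _ h => h.2) h3 h2,
        g, α, K, hα, h1, h2, fun b u hb hu => tendsto_shift_nhdsLT h3 b u hb hu⟩
    rcases hvM with h | h | h
    · obtain ⟨h1, h2⟩ := deriv_meanExcess_tendsto hmono hderiv h
      rw [hw, leftNhds_coe] at h1 h2
      refine ⟨_, 1, 1, 1, one_pos, h1, h2, ?_⟩
      filter_upwards [hlt, self_mem_nhdsWithin] with x hx hxw
      have hxw : x < w := hxw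
      have hpos : 0 < 1 - F x := sub_pos.2 hx
      have hS : {t : ℝ | x < t ∧ (t : EReal) < upperEndpoint F} = Set.Ioo x w := by
        ext t
        simp [hw]
      have hFt : ∀ t ∈ Set.Ioo x w, 0 ≤ 1 - F t := fun t ht =>
        (sub_pos.2 (lt_one_of_lt_upperEndpoint hmono
          (by rw [hw]; exact EReal.coe_lt_coe_iff.2 ht.2))).le
      have hnn : 0 ≤ integratedTail F x := by
        rw [integratedTail, hS]
        exact setIntegral_nonneg measurableSet_Ioo hFt
      -- Monotonicity of `1 - F` bounds the mean excess by the distance to the endpoint.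
      have hle : integratedTail F x ≤ (1 - F x) * (w - x) := by
        have hint := h.1 x
        rw [hS] at hint
        rw [integratedTail, hS]
        have := setIntegral_mono_on hint (integrableOn_const (C := 1 - F x) (by simp))
          measurableSet_Ioo (fun t ht => sub_le_sub_left (hmono ht.1.le) 1)
        refine this.trans (le_of_eq ?_)
        rw [setIntegral_const, smul_eq_mul, Real.volume_real_Ioo_of_le hxw.le, mul_comm]
      rw [abs_of_nonneg (div_nonneg hnn hpos.le), div_le_iff₀ hpos]
      linarith
    · rw [h.1] at hw
      exact absurd hw (EReal.coe_ne_top w).symm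
    · obtain ⟨w', hw', α, hα, h⟩ := h
      rw [hw, EReal.coe_eq_coe_iff] at hw'
      subst hw'
      refine ⟨fun x => w - x, α, 1, 1, hα, Eventually.of_forall fun x =>
        ⟨by fun_prop, ?_⟩, ?_, ?_⟩
      · rw [deriv_const_sub]; simp
      · refine h.congr fun x => ?_
        simp [mul_div_assoc]
      · filter_upwards [self_mem_nhdsWithin] with x hx
        rw [one_mul, abs_of_pos (sub_pos.2 hx)]

/-! ### Normalized levels and final reductions -/

/-- Expected numbers of exceedances over the normalized levels. -/
theorem tendsto_normalized_exceed {F : ℝ → ℝ} (hmono : Monotone F)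
    (hright : ∀ x, ContinuousWithinAt F (Set.Ici x) x)
    (hbot : Tendsto F atBot (𝓝 0)) (htop : Tendsto F atTop (𝓝 1))
    (hderiv : HasPosDerivNearEndpoint F) (hvM : VonMises1 F ∨ VonMises2 F ∨ VonMises3 F)
    (k : ℕ → ℕ) (hkinf : Tendsto (fun n => (k n : ℝ)) atTop atTop)
    (hksmall : Tendsto (fun n : ℕ => (k n : ℝ) / n) atTop (𝓝 0)) :
    (∀ᶠ n : ℕ in atTop, 1 - F (centering F n (k n)) = (k n : ℝ) / n) ∧
    ∀ c e : ℕ → ℝ, Tendsto (fun n => c n / scaling F n (k n)) atTop (𝓝 1) →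
      Tendsto (fun n => (e n - centering F n (k n)) / scaling F n (k n)) atTop (𝓝 0) → ∀ x : ℝ,
      Tendsto (fun n : ℕ => (k n - n * (1 - F (e n + c n * x))) / √(k n : ℝ)) atTop (𝓝 x) := by
  obtain ⟨hne, hord, hone, g, α, K, hg⟩ :=
    exists_isAuxiliaryScale hmono hbot htop hderiv hvM
  have hF1 : ∀ᶠ x in leftNhds (upperEndpoint F), F x < 1 :=
    (eventually_lt_upperEndpoint F).mono fun x hx => lt_one_of_lt_upperEndpoint hmono hx
  have hkn : ∀ᶠ n : ℕ in atTop, 0 < (n : ℝ) ∧ 0 < (k n : ℝ) := by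
    filter_upwards [eventually_gt_atTop 0, hkinf.eventually_gt_atTop 0] with n h1 h2
    exact ⟨by exact_mod_cast h1, h2⟩
  obtain ⟨hb, hFb⟩ := tendsto_genInv hord hmono hright
    (hderiv.mono fun x hx => hx.1.continuousAt) hF1 hone (fun n : ℕ => 1 - (k n : ℝ) / n)
    (by simpa using hksmall.const_sub 1)
    (by filter_upwards [hkn] with n hn; have := div_pos hn.2 hn.1; linarith)
  have hFb' : ∀ᶠ n : ℕ in atTop, 1 - F (centering F n (k n)) = (k n : ℝ) / n := by
    filter_upwards [hFb] with n hn
    rw [centering, hn, sub_sub_cancel]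
  refine ⟨hFb', fun c e hc he x => ?_⟩
  -- Since `a = (1 - F b) / (F' b √k)`, the level `e + c x` is `b + s a` with this `s → x`, the form
  -- required by the linearization with `r = √k`.
  have hs : Tendsto (fun n => (e n - centering F n (k n)) / scaling F n (k n) +
      c n / scaling F n (k n) * x) atTop (𝓝 x) := by
    simpa using he.add (hc.mul_const x)
  have hr : Tendsto (fun n => √(k n : ℝ)) atTop atTop := Real.tendsto_sqrt_atTop.comp hkinf
  have main := (tendsto_sqrt_mul_tail_ratio_sub_one hord hderiv hF1 hg _ _ _ x hb hs hr).neg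
  rw [neg_neg] at main
  refine main.congr' ?_
  filter_upwards [hkn, hFb', hb.eventually hderiv] with n ⟨hn, hk⟩ h1 h2
  have hpos : 0 < deriv F (centering F n (k n)) := h2.2
  have hsq := Real.sqrt_pos.2 hk
  have hkk : √(k n : ℝ) * √(k n : ℝ) = k n := Real.mul_self_sqrt hk.le
  have ha : scaling F n (k n) = √(k n : ℝ) / (n * deriv F (centering F n (k n))) := rfl
  have ha0 : 0 < scaling F n (k n) := by rw [ha]; positivity
  have hinv : ((k n : ℝ) / n / deriv F (centering F n (k n))) / √(k n : ℝ) =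
      scaling F n (k n) := by
    rw [ha]
    nth_rewrite 1 [← hkk]
    field_simp
  have hlevel : centering F n (k n) + ((e n - centering F n (k n)) / scaling F n (k n) +
      c n / scaling F n (k n) * x) / √(k n : ℝ) * ((1 - F (centering F n (k n))) /
      deriv F (centering F n (k n))) = e n + c n * x := by
    rw [h1, div_mul_eq_mul_div, mul_div_assoc, hinv]
    field_simp
    ring
  change -(√(k n : ℝ) * ((1 - F (centering F n (k n) + ((e n - centering F n (k n)) /
    scaling F n (k n) + c n / scaling F n (k n) * x) / √(k n : ℝ) *
    ((1 - F (centering F n (k n))) / deriv F (centering F n (k n))))) /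
    (1 - F (centering F n (k n))) - 1)) = _
  rw [hlevel, h1, eq_div_iff hsq.ne']
  have : -(√(k n : ℝ) * ((1 - F (e n + c n * x)) / ((k n : ℝ) / n) - 1)) * √(k n : ℝ) =
      -(√(k n : ℝ) * √(k n : ℝ)) * ((1 - F (e n + c n * x)) / ((k n : ℝ) / n) - 1) := by ring
  rw [this, hkk]
  field_simp
  ring

lemma norm_toLp_le_sum {d : ℕ} (v : EuclideanSpace ℝ (Fin d)) : ‖v‖ ≤ ∑ i, |v i| := by
  rw [EuclideanSpace.norm_eq]
  refine Real.sqrt_le_iff.2 ⟨Finset.sum_nonneg fun i _ => abs_nonneg _, ?_⟩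
  rw [sq, Finset.sum_mul]
  refine Finset.sum_le_sum fun i _ => ?_
  rw [sq, Real.norm_eq_abs]
  exact mul_le_mul_of_nonneg_left
    (Finset.single_le_sum (f := fun i => |v i|) (fun i _ => abs_nonneg _) (Finset.mem_univ i))
    (abs_nonneg _)

/-- Coordinatewise convergence in probability implies convergence in probability. -/
lemma tendstoInMeasure_euclidean {d : ℕ} {Ω : Type*} [MeasurableSpace Ω] (P : Measure Ω)
    (W : ℕ → Ω → EuclideanSpace ℝ (Fin d))
    (h : ∀ i, ∀ ε : ℝ, 0 < ε → Tendsto (fun n => P {ω | ε ≤ |W n ω i|}) atTop (𝓝 0)) :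
    TendstoInMeasure P W atTop 0 := by
  rw [tendstoInMeasure_iff_norm]
  intro ε hε
  -- Dividing by `d + 1` covers `d = 0` and makes the sum over coordinates strictly less than `ε`.
  have hη : 0 < ε / (d + 1) := by positivity
  have hlim : Tendsto (fun n => ∑ i, P {ω | ε / (d + 1) ≤ |W n ω i|}) atTop (𝓝 0) := by
    simpa using tendsto_finsetSum Finset.univ fun i _ => h i _ hη
  refine tendsto_of_tendsto_of_tendsto_of_le_of_le tendsto_const_nhds hlim
    (fun n => zero_le) fun n => ?_
  have hsub : {ω | ε ≤ ‖W n ω - (0 : Ω → EuclideanSpace ℝ (Fin d)) ω‖} ⊆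
      ⋃ i ∈ (Finset.univ : Finset (Fin d)), {ω | ε / (d + 1) ≤ |W n ω i|} := by
    intro ω hω
    by_contra hcon
    simp only [Set.mem_iUnion, not_exists, Finset.mem_univ, Set.mem_ofPred_eq, not_le] at hcon
    have h1 : ε ≤ ‖W n ω‖ := by simpa using hω
    have h2 := norm_toLp_le_sum (W n ω)
    have h3 : ∑ i, |W n ω i| ≤ ∑ _i : Fin d, ε / (d + 1) :=
      Finset.sum_le_sum fun i _ => (hcon i trivial).le
    rw [Finset.sum_const, Finset.card_univ, Fintype.card_fin, nsmul_eq_mul] at h3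
    have h4 : (d : ℝ) * (ε / (d + 1)) < ε := by
      rw [mul_div_assoc', div_lt_iff₀ (by positivity)]
      linarith
    linarith
  exact (measure_mono hsub).trans (measure_biUnion_finset_le _ _)

/-- If the ratios of finitely many nonnegative sequences converge and the norm diverges, then each
sequence diverges. -/
lemma tendsto_atTop_of_ratio {d : ℕ} (k : ℕ → Fin d → ℕ)
    (hk : ∀ n, 1 ≤ n → ∀ i, 1 ≤ k n i) (R : Fin d → Fin d → ℝ)
    (hratio : ∀ i j, Tendsto (fun n => (k n i : ℝ) / (k n j : ℝ)) atTop (𝓝 (R i j)))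
    (hkinf : Tendsto (fun n => ‖fun i => (k n i : ℝ)‖) atTop atTop) (i : Fin d) :
    Tendsto (fun n => (k n i : ℝ)) atTop atTop := by
  have hsum : Tendsto (fun n => ∑ j, (k n j : ℝ) / (k n i : ℝ)) atTop (𝓝 (∑ j, R j i)) :=
    tendsto_finsetSum _ fun j _ => hratio j i
  have hB : 0 < |∑ j, R j i| + 1 := by positivity
  -- `‖k‖ / k_i` is at most the sum of the ratios `k_j / k_i`, which is eventually bounded.
  refine tendsto_atTop_mono' _ ?_ (hkinf.atTop_div_const hB)
  filter_upwards [eventually_ge_atTop 1, hsum.eventually (gt_mem_nhds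
    (show ∑ j, R j i < |∑ j, R j i| + 1 by linarith [le_abs_self (∑ j, R j i)]))] with n hn h
  have hki : 0 < (k n i : ℝ) := by exact_mod_cast hk n hn i
  rw [div_le_iff₀ hB]
  have h1 : ‖fun i => (k n i : ℝ)‖ ≤ ∑ j, (k n j : ℝ) := by
    rw [pi_norm_le_iff_of_nonneg (Finset.sum_nonneg fun j _ => Nat.cast_nonneg _)]
    intro j
    rw [Real.norm_of_nonneg (Nat.cast_nonneg _)]
    exact Finset.single_le_sum (f := fun j => (k n j : ℝ)) (fun j _ => Nat.cast_nonneg _)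
      (Finset.mem_univ j)
  rw [← Finset.sum_div, div_lt_iff₀ hki] at h
  linarith

end IntermediateOS

/-! ### The main theorem -/

open IntermediateOS in
theorem proposition3p1 {d : ℕ}
    -- the law `μ` of `X` on `ℝ^d`; its distribution function is `F x = μ (-∞, x]`
    (μ : Measure (Fin d → ℝ)) [IsProbabilityMeasure μ]
    -- the copula of `F` and its `D`-norm expansion
    (C D : (Fin d → ℝ) → ℝ) (hC : IsCopula C)
    (hSklar : ∀ x : Fin d → ℝ, μ.real (Set.Iic x) = C (fun i => marginCDF μ i (x i)))
    (hD : IsDNorm D) (hexp : HasDNormExpansion C D)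
    -- von Mises conditions on the margins
    (hderiv : ∀ i, HasPosDerivNearEndpoint (marginCDF μ i))
    (hvM : ∀ i, VonMises1 (marginCDF μ i) ∨ VonMises2 (marginCDF μ i) ∨ VonMises3 (marginCDF μ i))
    -- independent copies `X 0, X 1, …` of the random vector
    {Ω : Type*} [MeasurableSpace Ω] (P : Measure Ω) [IsProbabilityMeasure P]
    (X : ℕ → Ω → Fin d → ℝ) (hlaw : ∀ j, HasLaw (X j) μ P) (hindep : iIndepFun X P)
    -- the intermediate sequences `k n i`
    (k : ℕ → Fin d → ℕ) (hk : ∀ n, 1 ≤ n → ∀ i, 1 ≤ k n i ∧ k n i ≤ n)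
    (κ : Fin d → Fin d → ℝ) (hκ : ∀ i j, 0 < κ i j)
    (hratio : ∀ i j, Tendsto (fun n => (k n i : ℝ) / (k n j : ℝ)) atTop (𝓝 (κ i j ^ 2)))
    (hkinf : Tendsto (fun n => ‖fun i => (k n i : ℝ)‖) atTop atTop)
    (hksmall : Tendsto (fun n : ℕ => ‖fun i => (k n i : ℝ)‖ / (n : ℝ)) atTop (𝓝 0))
    -- the norming constants
    (c e : ℕ → Fin d → ℝ) (hcpos : ∀ n, 1 ≤ n → ∀ i, 0 < c n i)
    (hc : ∀ i, Tendsto (fun n => c n i / scaling (marginCDF μ i) n (k n i)) atTop (𝓝 1))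
    (he : ∀ i, Tendsto (fun n => (e n i - centering (marginCDF μ i) n (k n i)) /
      scaling (marginCDF μ i) n (k n i)) atTop (𝓝 0)) :
    (asympCov D κ).PosSemidef ∧
    TendstoInDistribution
      (fun (n : ℕ) (ω : Ω) => WithLp.toLp 2 (fun i =>
        (orderStat (fun j => X j ω i) n (n - k n i + 1) - e n i) / c n i))
      atTop (fun z : EuclideanSpace ℝ (Fin d) => z) (fun _ => P)
      (multivariateGaussian 0 (asympCov D κ)) := by
  have hkinf_i : ∀ i, Tendsto (fun n => (k n i : ℝ)) atTop atTop :=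
    tendsto_atTop_of_ratio k (fun n hn i => (hk n hn i).1) _ hratio hkinf
  have hksmall_i : ∀ i, Tendsto (fun n : ℕ => (k n i : ℝ) / (n : ℝ)) atTop (𝓝 0) := fun i =>
    squeeze_zero (fun n => by positivity) (fun n => div_le_div_of_nonneg_right
      ((le_abs_self _).trans (norm_le_pi_norm (fun i => (k n i : ℝ)) i)) (Nat.cast_nonneg n))
      hksmall
  have hlevels := fun i => tendsto_normalized_exceed (F := marginCDF μ i) (monotone_cdf _)
    (fun x => (cdf _).right_continuous x) (tendsto_cdf_atBot _) (tendsto_cdf_atTop _) (hderiv i)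
    (hvM i) (fun n => k n i) (hkinf_i i) (hksmall_i i)
  set ν : Fin d → Measure ℝ := fun i => μ.map (fun x => x i) with hν
  have hνp : ∀ i, IsProbabilityMeasure (ν i) := isProbabilityMeasure_margin μ
  set b : ℕ → Fin d → ℝ := fun n i => centering (marginCDF μ i) n (k n i) with hb
  set ψ : ℕ → Fin d → (Fin d → ℝ) → ℝ := fun n i x =>
    centredExceed (ν i) (b n i) (x i) / √(k n i : ℝ) with hψ
  have hψm : ∀ n i, Measurable (ψ n i) := fun n i =>
    ((measurable_centredExceed _ _).comp (measurable_pi_apply i)).div_const _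
  have hψb : ∀ n i x, |ψ n i x| ≤ 1 / √(k n i : ℝ) := fun n i x => by
    simp only [hψ]
    rw [abs_div, abs_of_nonneg (Real.sqrt_nonneg _)]
    exact div_le_div_of_nonneg_right (abs_centredExceed_le _ _ _) (Real.sqrt_nonneg _)
  have hψ0 : ∀ n i, ∫ x, ψ n i x ∂μ = 0 := fun n i => by
    simp only [hψ]
    rw [integral_div, ← integral_map (φ := fun x : Fin d → ℝ => x i)
      (f := centredExceed (ν i) (b n i)) (measurable_pi_apply i).aemeasurable
      (measurable_centredExceed _ _).aestronglyMeasurable, integral_centredExceed, zero_div]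
  have hcov : ∀ i j, Tendsto (fun n : ℕ => n * ∫ x, ψ n i x * ψ n j x ∂μ) atTop
      (𝓝 (asympCov D κ i j)) :=
    tendsto_cov_centredExceed μ C D hSklar hD hexp k hk κ hκ hratio hksmall_i b
      fun i => (hlevels i).1
  have hPSD : (asympCov D κ).PosSemidef := by
    refine posSemidef_of_tendsto_integral_mul μ ψ (fun n i j => ?_) _ hcov
    refine Integrable.of_bound ((hψm n i).mul (hψm n j)).aestronglyMeasurable
      (1 / √(k n i : ℝ) * (1 / √(k n j : ℝ))) (ae_of_all _ fun x => ?_)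
    rw [norm_mul]
    exact mul_le_mul (hψb n i x) (hψb n j x) (norm_nonneg _) (by positivity)
  refine ⟨hPSD, ?_⟩
  have hclt := tendstoInDistribution_sum_triangular μ P X hlaw hindep ψ hψm
    (fun n i => 1 / √(k n i : ℝ))
    (fun i => tendsto_const_nhds.div_atTop (Real.tendsto_sqrt_atTop.comp (hkinf_i i)))
    hψb hψ0 _ hPSD hcov
  -- Slutsky: the order statistics inherit the limit of the exceedance counts, so only
  -- coordinatewise closeness in probability remains, besides measurability.
  refine tendstoInDistribution_of_tendstoInMeasure_sub _ _ hclt ?_ ?_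
  · refine tendstoInMeasure_euclidean P _ fun i ε hε => ?_
    have hlaw_i : ∀ j, HasLaw (fun ω => X j ω i) (ν i) P := fun j =>
      ⟨(measurable_pi_apply i).comp_aemeasurable (hlaw j).aemeasurable, by
        change _ = μ.map (fun x => x i)
        rw [← (hlaw j).map_eq, AEMeasurable.map_map_of_aemeasurable
          (measurable_pi_apply i).aemeasurable (hlaw j).aemeasurable]
        rfl⟩
    have hindep_i : iIndepFun (fun j ω => X j ω i) P :=
      hindep.comp (fun _ x => x i) (fun _ => measurable_pi_apply i)
    refine (tendsto_measure_abs_orderStat_sub P (ν i) (fun j ω => X j ω i) hlaw_i hindep_i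
      (fun n => k n i) (fun n hn => hk n hn i) (hkinf_i i) (fun n => b n i) ?_
      (fun n => c n i) (fun n => e n i) (fun n hn => hcpos n hn i) ?_ ε hε).congr fun n => ?_
    · filter_upwards [(hlevels i).1, eventually_gt_atTop 0] with n hn hn0
      have hn0 : (0 : ℝ) < n := by exact_mod_cast hn0
      rw [margin_real_Ioi, hn]
      field_simp
    · intro x
      refine ((hlevels i).2 (fun n => c n i) (fun n => e n i) (hc i) (he i) x).congr fun n => ?_
      rw [margin_real_Ioi]
    · rfl
  · intro n
    refine (WithLp.measurable_toLp 2 _).comp_aemeasurable (aemeasurable_pi_lambda _ fun i => ?_)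
    refine AEMeasurable.div_const (AEMeasurable.sub_const ?_ _) _
    exact (measurable_orderStat n _).comp_aemeasurable (aemeasurable_pi_lambda _ fun j =>
      (measurable_pi_apply i).comp_aemeasurable (hlaw j).aemeasurable)
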